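/- Let $d\ge 1$, let $R_+$ be the set of positive roots of a root system in $\mathbb R^d$ (a finite set of nonzero vectors stable under the reflections $\sigma_v x = x-2\langle x,v\rangle v/\|v\|^2$ in its members; $R_+$ consists of the roots on the positive side of a hyperplane containing no root), and let $G$ be the finite reflection group generated by $\{\sigma_v: v\in R_+\}$. Let $\kappa:R_+\to[0,\infty)$ satisfy $\kappa_u=\kappa_v$ whenever $\sigma_u$ and $\sigma_v$ are conjugate in $G$, and put $h_\kappa(x)=\prod_{v\in R_+}|\langle x,v\rangle|^{\kappa_v}$ and $\gamma_\kappa=\sum_{v\in R_+}\kappa_v$. For $\mu\ge 0$ and $x$ in the unit ball $\mathbb B^d$ let $$W_{\kappa,\mu}(x)=h_\kappa^2(x)\,(1-\|x\|^2)^{\mu-1/2},\qquad b_{\kappa,\mu}=\Big(\int_{\mathbb B^d}W_{\kappa,\mu}\,dx\Big)^{-1},\qquad \|f\|_{L^2(\mathbb B^d,W_{\kappa,\mu})}=\Big(b_{\kappa,\mu}\int_{\mathbb B^d}|f|^2W_{\kappa,\mu}\,dx\Big)^{1/2}.$$ Let $W_2^1(\mathbb B^d,W_{\kappa,\mu})$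 be the space of $f\in L^2(\mathbb B^d,W_{\kappa,\mu})$ whose first order weak derivatives (taken on the open set $\{\|x\|<1,\ h_\kappa(x)\ne0\}$) all lie in $L^2(\mathbb B^d,W_{\kappa,\mu})$. Write $|\nabla_D f|^2=\sum_{1\le i<j\le d}|x_i\partial_jf-x_j\partial_if|^2$ and $$|||\nabla f|||^2=\|\nabla f\|^2_{L^2(\mathbb B^d,W_{\kappa,\mu+1})}+\|\nabla_Df\|^2_{L^2(\mathbb B^d,W_{\kappa,\mu})}.$$ **Theorem.** Let $f\in W_2^1(\mathbb B^d,W_{\kappa,\mu})$, real or complex valued, be $G$-invariant (almost everywhere), with $\int_{\mathbb B^d}f\,W_{\kappa,\mu}\,dx=0$ and $\|f\|_{L^2(\mathbb B^d,W_{\kappa,\mu})}=1$. Then $$\min_{1\le i\le d}\ b_{\kappa,\mu}\int_{\mathbb B^d}(1-x_i)|f(x)|^2W_{\kappa,\mu}(x)\,dx\;\cdot\;|||\nabla f|||^2\ \ge\ C_{\kappa,\mu},$$ where, with $\lambda_{\kappa,\mu}=\gamma_\kappa+\mu+\frac{d-1}{2}$, $$C_{\kappa,\mu}=2\lambda_{\kappa,\mu}\left(1-\frac{\sqrt{2\lambda_{\kappa,\mu}}}{\sqrt{(\lambda_{\kappa,\mu}+\frac12)^2+2\lambda_{\kappa,\mu}}}\right).$$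 The same inequality holds when, in $|||\nabla f|||^2$, the term $\|\nabla f\|^2_{L^2(\mathbb B^d,W_{\kappa,\mu+1})}=b_{\kappa,\mu+1}\int_{\mathbb B^d}|\nabla f|^2W_{\kappa,\mu+1}\,dx$ is replaced by $b_{\kappa,\mu}\int_{\mathbb B^d}|\nabla f|^2W_{\kappa,\mu+1}\,dx$. -/

import Mathlib

open MeasureTheory
open scoped ContDiff InnerProductSpace

namespace BallUncertainty

variable {d : ℕ}

/-- The reflection `x ↦ x - 2⟨x, v⟩ v / ‖v‖²` in the hyperplane orthogonal to `v`. -/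
noncomputable def refl (v : EuclideanSpace ℝ (Fin d)) :
    EuclideanSpace ℝ (Fin d) ≃ₗᵢ[ℝ] EuclideanSpace ℝ (Fin d) :=
  (ℝ ∙ v)ᗮ.reflection

/-- The defining formula of the reflection. -/
theorem refl_apply (v x : EuclideanSpace ℝ (Fin d)) :
    refl v x = x - (2 * ⟪x, v⟫_ℝ / ‖v‖ ^ 2) • v := by
  rw [refl, Submodule.reflection_orthogonal_apply, Submodule.reflection_singleton_apply,
    real_inner_comm]
  simp only [RCLike.ofReal_real_eq_id, id_eq, neg_sub, two_smul, ← add_smul]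
  congr 2
  ring

/-- A root system in `ℝ^d`: a finite set of nonzero vectors stable under its own reflections. -/
structure IsRootSystem (R : Finset (EuclideanSpace ℝ (Fin d))) : Prop where
  ne_zero : ∀ v ∈ R, v ≠ 0
  refl_mem : ∀ u ∈ R, ∀ v ∈ R, refl v u ∈ R

/-- `P` is the set of positive roots of some root system, i.e. the set of roots lying on the
positive side of a hyperplane that contains no root. -/
def IsPositiveRootSystem (P : Finset (EuclideanSpace ℝ (Fin d))) : Prop :=
  ∃ R : Finset (EuclideanSpace ℝ (Fin d)), IsRootSystem R ∧
    ∃ u : EuclideanSpace ℝ (Fin d), (∀ v ∈ R, ⟪u, v⟫_ℝ ≠ 0) ∧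
      ∀ v, v ∈ P ↔ v ∈ R ∧ 0 < ⟪u, v⟫_ℝ

/-- The reflection group generated by the reflections in the positive roots. -/
noncomputable def reflGroup (P : Finset (EuclideanSpace ℝ (Fin d))) :
    Subgroup (EuclideanSpace ℝ (Fin d) ≃ₗᵢ[ℝ] EuclideanSpace ℝ (Fin d)) :=
  Subgroup.closure (refl '' (P : Set (EuclideanSpace ℝ (Fin d))))

/-- A nonnegative multiplicity function on the positive roots: roots whose reflections are
conjugate in the reflection group get the same value. -/
structure IsMultiplicity (P : Finset (EuclideanSpace ℝ (Fin d)))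
    (κ : EuclideanSpace ℝ (Fin d) → ℝ) : Prop where
  nonneg : ∀ v ∈ P, 0 ≤ κ v
  conj : ∀ u ∈ P, ∀ v ∈ P, (∃ g ∈ reflGroup P, g * refl u * g⁻¹ = refl v) → κ u = κ v

/-- `h_κ(x) = ∏_{v ∈ R₊} |⟨x, v⟩|^{κ_v}`. -/
noncomputable def hWeight (P : Finset (EuclideanSpace ℝ (Fin d)))
    (κ : EuclideanSpace ℝ (Fin d) → ℝ) (x : EuclideanSpace ℝ (Fin d)) : ℝ :=
  ∏ v ∈ P, |⟪x, v⟫_ℝ| ^ κ v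

/-- The closed unit ball. -/
def unitBall (d : ℕ) : Set (EuclideanSpace ℝ (Fin d)) := Metric.closedBall 0 1

/-- `W_{κ,μ}(x) = h_κ(x)² (1 - ‖x‖²)^{μ - 1/2}`, considered on the unit ball. -/
noncomputable def ballWeight (P : Finset (EuclideanSpace ℝ (Fin d)))
    (κ : EuclideanSpace ℝ (Fin d) → ℝ) (μ : ℝ) (x : EuclideanSpace ℝ (Fin d)) : ℝ :=
  hWeight P κ x ^ 2 * (1 - ‖x‖ ^ 2) ^ (μ - 1 / 2)

/-- The normalization constant `b_{κ,μ}`, for which `b_{κ,μ} ∫ W_{κ,μ} = 1`. -/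
noncomputable def normConst (P : Finset (EuclideanSpace ℝ (Fin d)))
    (κ : EuclideanSpace ℝ (Fin d) → ℝ) (μ : ℝ) : ℝ :=
  (∫ x in unitBall d, ballWeight P κ μ x)⁻¹

/-- Membership in `L²(𝔹^d, W_{κ,μ})`, for scalar or vector valued functions. -/
def MemL2 {V : Type*} [NormedAddCommGroup V] (P : Finset (EuclideanSpace ℝ (Fin d)))
    (κ : EuclideanSpace ℝ (Fin d) → ℝ) (μ : ℝ) (F : EuclideanSpace ℝ (Fin d) → V) : Prop :=
  AEStronglyMeasurable F (volume.restrict (unitBall d)) ∧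
    IntegrableOn (fun x => ‖F x‖ ^ 2 * ballWeight P κ μ x) (unitBall d)

/-- The normalized norm `(b_{κ,μ} ∫ |F|² W_{κ,μ})^{1/2}` of `L²(𝔹^d, W_{κ,μ})`. -/
noncomputable def normL2 {V : Type*} [NormedAddCommGroup V]
    (P : Finset (EuclideanSpace ℝ (Fin d))) (κ : EuclideanSpace ℝ (Fin d) → ℝ) (μ : ℝ)
    (F : EuclideanSpace ℝ (Fin d) → V) : ℝ :=
  Real.sqrt (normConst P κ μ * ∫ x in unitBall d, ‖F x‖ ^ 2 * ballWeight P κ μ x)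

/-- The open set of points of the open unit ball at which `h_κ` does not vanish, i.e. the open
ball without the mirrors of the roots `v` with `κ_v > 0`. Functions in `L²(𝔹^d, W_{κ,μ})` are
locally integrable on this set, but in general not across these mirrors, so this is the domain
on which distributional derivatives are taken. If `κ = 0`, it is the whole open ball. -/
def regularSet (P : Finset (EuclideanSpace ℝ (Fin d)))
    (κ : EuclideanSpace ℝ (Fin d) → ℝ) : Set (EuclideanSpace ℝ (Fin d)) :=
  {x | ‖x‖ < 1 ∧ hWeight P κ x ≠ 0}

/-- `g` is the weak (distributional) gradient of `f` on the open set `Ω`. -/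
structure HasWeakGradient {𝕜 : Type*} [RCLike 𝕜] (Ω : Set (EuclideanSpace ℝ (Fin d)))
    (f : EuclideanSpace ℝ (Fin d) → 𝕜)
    (g : EuclideanSpace ℝ (Fin d) → EuclideanSpace 𝕜 (Fin d)) : Prop where
  locallyIntegrable : LocallyIntegrableOn f Ω
  locallyIntegrable_grad : LocallyIntegrableOn g Ω
  integral_eq : ∀ φ : EuclideanSpace ℝ (Fin d) → ℝ, ContDiff ℝ ∞ φ → HasCompactSupport φ →
    tsupport φ ⊆ Ω → ∀ i : Fin d,
      ∫ x in Ω, fderiv ℝ φ x (EuclideanSpace.single i 1) • f x = - ∫ x in Ω, φ x • g x i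

/-- The weighted Sobolev space `W_2^1(𝔹^d, W_{κ,μ})`: functions in `L²(𝔹^d, W_{κ,μ})` all of
whose first order weak derivatives are in `L²(𝔹^d, W_{κ,μ})`. -/
def MemSobolev {𝕜 : Type*} [RCLike 𝕜] (P : Finset (EuclideanSpace ℝ (Fin d)))
    (κ : EuclideanSpace ℝ (Fin d) → ℝ) (μ : ℝ) (f : EuclideanSpace ℝ (Fin d) → 𝕜) : Prop :=
  MemL2 P κ μ f ∧ ∃ g : EuclideanSpace ℝ (Fin d) → EuclideanSpace 𝕜 (Fin d),
    HasWeakGradient (regularSet P κ) f g ∧ MemL2 P κ μ g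

/-- Invariance (of the class of `f` modulo null sets) under the reflection group. -/
def IsInvariant {𝕜 : Type*} (P : Finset (EuclideanSpace ℝ (Fin d)))
    (f : EuclideanSpace ℝ (Fin d) → 𝕜) : Prop :=
  ∀ s ∈ reflGroup P, ∀ᵐ x ∂(volume.restrict (unitBall d)), f (s x) = f x

/-- `|∇_D f(x)| = (∑_{i<j} |x_i ∂_j f(x) - x_j ∂_i f(x)|²)^{1/2}`, where `g = ∇f`. -/
noncomputable def angularGradNorm {𝕜 : Type*} [RCLike 𝕜]
    (g : EuclideanSpace ℝ (Fin d) → EuclideanSpace 𝕜 (Fin d))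
    (x : EuclideanSpace ℝ (Fin d)) : ℝ :=
  Real.sqrt (∑ i : Fin d, ∑ j : Fin d,
    if i < j then ‖(x i : 𝕜) * g x j - (x j : 𝕜) * g x i‖ ^ 2 else 0)

/-- `‖∇f‖²_{L²(W_{κ,μ+1})} + ‖∇_D f‖²_{L²(W_{κ,μ})}`, each norm with its own normalization
(`b_{κ,μ+1}` and `b_{κ,μ}`, respectively); here `g = ∇f`. -/
noncomputable def tripleNormSq {𝕜 : Type*} [RCLike 𝕜] (P : Finset (EuclideanSpace ℝ (Fin d)))
    (κ : EuclideanSpace ℝ (Fin d) → ℝ) (μ : ℝ)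
    (g : EuclideanSpace ℝ (Fin d) → EuclideanSpace 𝕜 (Fin d)) : ℝ :=
  normL2 P κ (μ + 1) g ^ 2 + normL2 P κ μ (angularGradNorm g) ^ 2

/-- The same quantity with the common normalization `b_{κ,μ}`:
`b_{κ,μ} ∫ |∇f|² W_{κ,μ+1} + ‖∇_D f‖²_{L²(W_{κ,μ})}`; here `g = ∇f`. -/
noncomputable def tripleNormSqCommon {𝕜 : Type*} [RCLike 𝕜]
    (P : Finset (EuclideanSpace ℝ (Fin d))) (κ : EuclideanSpace ℝ (Fin d) → ℝ) (μ : ℝ)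
    (g : EuclideanSpace ℝ (Fin d) → EuclideanSpace 𝕜 (Fin d)) : ℝ :=
  normConst P κ μ * (∫ x in unitBall d, ‖g x‖ ^ 2 * ballWeight P κ (μ + 1) x)
    + normL2 P κ μ (angularGradNorm g) ^ 2

/-- `λ_{κ,μ} = γ_κ + μ + (d - 1)/2` with `γ_κ = ∑_{v ∈ R₊} κ_v`. -/
noncomputable def lam (P : Finset (EuclideanSpace ℝ (Fin d)))
    (κ : EuclideanSpace ℝ (Fin d) → ℝ) (μ : ℝ) : ℝ :=
  (∑ v ∈ P, κ v) + μ + ((d : ℝ) - 1) / 2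

/-- The constant `C_{κ,μ}`. -/
noncomputable def uncertaintyConst (P : Finset (EuclideanSpace ℝ (Fin d)))
    (κ : EuclideanSpace ℝ (Fin d) → ℝ) (μ : ℝ) : ℝ :=
  2 * lam P κ μ *
    (1 - Real.sqrt (2 * lam P κ μ) / Real.sqrt ((lam P κ μ + 1 / 2) ^ 2 + 2 * lam P κ μ))

/-- `min_{1 ≤ i ≤ d} b_{κ,μ} ∫ (1 - x_i) |f(x)|² W_{κ,μ}(x) dx`. -/
noncomputable def minSpread {𝕜 : Type*} [RCLike 𝕜] [NeZero d]
    (P : Finset (EuclideanSpace ℝ (Fin d))) (κ : EuclideanSpace ℝ (Fin d) → ℝ) (μ : ℝ)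
    (f : EuclideanSpace ℝ (Fin d) → 𝕜) : ℝ :=
  Finset.univ.inf' Finset.univ_nonempty fun i : Fin d =>
    normConst P κ μ * ∫ x in unitBall d, (1 - x i) * ‖f x‖ ^ 2 * ballWeight P κ μ x

end BallUncertainty

/-! Let `ν` be the probability measure with density `b_{κ,μ} W_{κ,μ}` and `E(f) = ∫ (‖∇f‖² - ⟨x,
∇f⟩²) dν`. By Lagrange's identity, `E(f)` is the common-normalization version of `|||∇f|||²`
(`angularGradNorm_sq`, `tripleNormSqCommon_eq`). The other version is at least as large because
`b_{κ,μ} ≤ b_{κ,μ+1}`, so it suffices to bound `E` from below.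

The form `E` comes from a second order operator `L` (`ballOp`): for an invariant polynomial `p`,
Green's identity `integral_ballField_eq` pairs `∇f` with `∇p` to give `-∫ f Lp dν`. No boundary term
appears, because the field `∇p - (x·∇p)x` is tangent to the sphere and to every mirror
(`sum_logGrad_mul_ballField`).

Spectral gap: `L` does not raise degrees and multiplies the part of degree `n` by `-n(n+2λ)` modulo
lower degrees (`ballOp_add_mem_degreeLT`). The orthogonal projections of `f` to polynomials of
bounded degree are invariant, their increments are orthogonal in `L²(ν)` and for the energy, and
mean zero kills the constant. Hence `E(f) ≥ 2λ` when `‖f‖ = 1` (`spectral_gap_projection`).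

Commutator bound: if `u` is orthogonal to all roots and `‖u‖ ≤ 1`, the linear form `⟨x, u⟩` is an
eigenfunction of `L` with eigenvalue `-(2λ+1)`. Pairing it with the square of a polynomial and
completing a square (`commutator_poly`), then passing to the limit and using nonnegativity of a
variance, gives `(2λ+1)τ - (1-τ²)/t ≤ tE` for all `t > 0`, where `τ = ∫ ⟨x, u⟩ |f|² dν`.

For a coordinate `x_i`, take `u` to be the component of `e_i` orthogonal to the roots. The rest of
`e_i` lies in the span of the roots and integrates to zero against the invariant `|f|²`, so the
spread is `1 - τ`. If `τ` is small the gap bounds `(1-τ)E` from below; if `τ` is large the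
commutator bound does; the constant is the value where they meet (`scalar_uncertainty`). Complex
values are treated through real and imaginary parts, added before the scalar step. -/

namespace BallUncertainty

variable {d : ℕ}

/-! ### Polynomials of bounded degree -/

/-- Polynomials all of whose monomials have degree less than `n`. -/
noncomputable def degreeLT (d n : ℕ) : Submodule ℝ (MvPolynomial (Fin d) ℝ) :=
  MvPolynomial.restrictSupport ℝ {m | m.degree < n}

theorem mem_degreeLT {n : ℕ} {p : MvPolynomial (Fin d) ℝ} :
    p ∈ degreeLT d n ↔ ∀ m, n ≤ m.degree → p.coeff m = 0 := by
  rw [degreeLT, MvPolynomial.mem_restrictSupport_iff]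
  constructor
  · intro h m hm
    by_contra h0
    exact absurd (h (MvPolynomial.mem_support_iff.mpr h0)) (by simpa using hm)
  · intro h m hm
    by_contra h0
    exact MvPolynomial.mem_support_iff.mp hm (h m (by simpa using h0))

theorem degreeLT_mono {m n : ℕ} (h : m ≤ n) : degreeLT d m ≤ degreeLT d n := fun _ hp =>
  mem_degreeLT.mpr fun k hk => mem_degreeLT.mp hp k (h.trans hk)

theorem mem_degreeLT_totalDegree {n : ℕ} {p : MvPolynomial (Fin d) ℝ} (h : p.totalDegree < n) :
    p ∈ degreeLT d n :=
  mem_degreeLT.mpr fun _ hm => MvPolynomial.coeff_eq_zero_of_totalDegree_lt (h.trans_le hm)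

theorem totalDegree_lt_of_mem_degreeLT {n : ℕ} {p : MvPolynomial (Fin d) ℝ}
    (h : p ∈ degreeLT d n) (h0 : p ≠ 0) : p.totalDegree < n := by
  have hs : p.support.Nonempty := MvPolynomial.support_nonempty.mpr h0
  obtain ⟨m, hm, he⟩ := Finset.exists_mem_eq_sup p.support hs (fun s => s.sum fun _ e => e)
  rw [MvPolynomial.totalDegree, he]
  by_contra hn
  exact MvPolynomial.mem_support_iff.mp hm (mem_degreeLT.mp h m (not_lt.mp hn))

/-- The strict degree bound makes the filtration start at the zero space, which gives the induction
of `spectral_gap_projection` a trivial base. -/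
theorem degreeLT_zero {p : MvPolynomial (Fin d) ℝ} (h : p ∈ degreeLT d 0) : p = 0 := by
  ext m
  simpa using mem_degreeLT.mp h m (Nat.zero_le _)

theorem degreeLT_one {p : MvPolynomial (Fin d) ℝ} (h : p ∈ degreeLT d 1) :
    ∃ c, p = MvPolynomial.C c := by
  by_cases h0 : p = 0
  · exact ⟨0, by simp [h0]⟩
  · exact ⟨_, MvPolynomial.totalDegree_eq_zero_iff_eq_C.mp
      (Nat.lt_one_iff.mp (totalDegree_lt_of_mem_degreeLT h h0))⟩

/-- Finite dimension is what makes the orthogonal projection in `exists_orthogonal_projection`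
available. -/
instance finite_degreeLT (n : ℕ) : Module.Finite ℝ (degreeLT d n) := by
  have h : degreeLT d n ≤ MvPolynomial.restrictTotalDegree (Fin d) ℝ n := fun p hp => by
    rw [MvPolynomial.mem_restrictTotalDegree]
    by_cases h0 : p = 0
    · simp [h0]
    · exact (totalDegree_lt_of_mem_degreeLT hp h0).le
  exact Submodule.finiteDimensional_of_le h

theorem pderiv_mem_degreeLT {n : ℕ} {p : MvPolynomial (Fin d) ℝ} (h : p ∈ degreeLT d (n + 1))
    (i : Fin d) : MvPolynomial.pderiv i p ∈ degreeLT d n := by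
  refine mem_degreeLT.mpr fun m hm => ?_
  rw [MvPolynomial.coeff_pderiv, mem_degreeLT.mp h, zero_mul]
  simp [hm]

theorem C_mul_mem_degreeLT {n : ℕ} {p : MvPolynomial (Fin d) ℝ} (h : p ∈ degreeLT d n) (c : ℝ) :
    MvPolynomial.C c * p ∈ degreeLT d n := by
  rw [← MvPolynomial.smul_eq_C_mul]
  exact Submodule.smul_mem _ _ h

/-! ### Euler operator, directional derivatives and reflections of polynomials -/

/-- The Euler operator `p ↦ x · ∇p`. -/
noncomputable def euler : MvPolynomial (Fin d) ℝ →ₗ[ℝ] MvPolynomial (Fin d) ℝ :=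
  ∑ i, LinearMap.mulLeft ℝ (MvPolynomial.X i) ∘ₗ (MvPolynomial.pderiv i).toLinearMap

theorem euler_apply (p : MvPolynomial (Fin d) ℝ) :
    euler p = ∑ i, MvPolynomial.X i * MvPolynomial.pderiv i p := by
  simp [euler]

theorem euler_monomial (m : Fin d →₀ ℕ) (r : ℝ) :
    euler (MvPolynomial.monomial m r) = (m.degree : ℝ) • MvPolynomial.monomial m r := by
  rw [euler_apply]
  simp_rw [MvPolynomial.X_mul_pderiv_monomial]
  rw [← Finset.sum_smul, Finsupp.degree_eq_sum, ← Nat.cast_smul_eq_nsmul ℝ]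

theorem coeff_euler (p : MvPolynomial (Fin d) ℝ) (m : Fin d →₀ ℕ) :
    (euler p).coeff m = m.degree * p.coeff m := by
  induction p using MvPolynomial.induction_on' with
  | monomial k r =>
    rw [euler_monomial, MvPolynomial.coeff_smul, MvPolynomial.coeff_monomial]
    split_ifs with h
    · simp [h]
    · simp
  | add p q hp hq => rw [map_add, MvPolynomial.coeff_add, hp, hq, MvPolynomial.coeff_add, mul_add]

theorem euler_mem_degreeLT {n : ℕ} {p : MvPolynomial (Fin d) ℝ} (h : p ∈ degreeLT d n) :
    euler p ∈ degreeLT d n :=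
  mem_degreeLT.mpr fun m hm => by rw [coeff_euler, mem_degreeLT.mp h m hm, mul_zero]

/-- The Euler operator multiplies each monomial by its degree, so subtracting `n` times `p` cancels
the top part. -/
theorem euler_sub_mem_degreeLT {n : ℕ} {p : MvPolynomial (Fin d) ℝ}
    (h : p ∈ degreeLT d (n + 1)) : euler p - (n : ℝ) • p ∈ degreeLT d n :=
  mem_degreeLT.mpr fun m hm => by
    rw [MvPolynomial.coeff_sub, coeff_euler, MvPolynomial.coeff_smul, smul_eq_mul]
    rcases hm.eq_or_lt with rfl | hm
    · simp
    · rw [mem_degreeLT.mp h m hm]; simp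

/-- The linear form `x ↦ ⟨x, v⟩` as a polynomial. -/
noncomputable def linForm (v : EuclideanSpace ℝ (Fin d)) : MvPolynomial (Fin d) ℝ :=
  ∑ i, MvPolynomial.C (v i) * MvPolynomial.X i

/-- The derivative of a polynomial in direction `v`. -/
noncomputable def dirDeriv (v : EuclideanSpace ℝ (Fin d)) (p : MvPolynomial (Fin d) ℝ) :
    MvPolynomial (Fin d) ℝ :=
  ∑ i, MvPolynomial.C (v i) * MvPolynomial.pderiv i p

/-- The composition of a polynomial with the reflection along `v`. -/
noncomputable def reflPoly (v : EuclideanSpace ℝ (Fin d)) :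
    MvPolynomial (Fin d) ℝ →ₐ[ℝ] MvPolynomial (Fin d) ℝ :=
  MvPolynomial.aeval fun i =>
    MvPolynomial.X i - MvPolynomial.C (2 / ‖v‖ ^ 2 * v i) * linForm v

theorem eval_linForm (v x : EuclideanSpace ℝ (Fin d)) :
    MvPolynomial.eval x (linForm v) = ⟪x, v⟫_ℝ := by
  simp [linForm, PiLp.inner_apply]

theorem eval_reflPoly (v x : EuclideanSpace ℝ (Fin d)) (p : MvPolynomial (Fin d) ℝ) :
    MvPolynomial.eval x (reflPoly v p) = MvPolynomial.eval (refl v x) p := by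
  induction p using MvPolynomial.induction_on with
  | C a => simp [reflPoly]
  | add p q hp hq => simp [hp, hq]
  | mul_X p i hp =>
    rw [map_mul, map_mul, hp, map_mul, reflPoly, MvPolynomial.aeval_X]
    simp only [map_sub, map_mul, MvPolynomial.eval_X, MvPolynomial.eval_C, eval_linForm,
      refl_apply, PiLp.sub_apply, PiLp.smul_apply, smul_eq_mul]
    ring

theorem linForm_ne_zero {v : EuclideanSpace ℝ (Fin d)} (hv : v ≠ 0) : linForm v ≠ 0 := by
  intro h
  have := eval_linForm v v
  rw [h, map_zero, real_inner_self_eq_norm_sq] at this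
  exact hv (by simpa using this.symm)

theorem linForm_mem_degreeLT (v : EuclideanSpace ℝ (Fin d)) : linForm v ∈ degreeLT d 2 := by
  refine Submodule.sum_mem _ fun i _ => C_mul_mem_degreeLT ?_ _
  exact mem_degreeLT_totalDegree (by simp)

theorem pderiv_linForm (v : EuclideanSpace ℝ (Fin d)) (i : Fin d) :
    MvPolynomial.pderiv i (linForm v) = MvPolynomial.C (v i) := by
  simp [linForm, MvPolynomial.pderiv_X, Pi.single_apply]

theorem reflPoly_mem_degreeLT (v : EuclideanSpace ℝ (Fin d)) {n : ℕ}
    {p : MvPolynomial (Fin d) ℝ} (h : p ∈ degreeLT d n) : reflPoly v p ∈ degreeLT d n := by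
  classical
  by_cases h0 : p = 0
  · simp [h0]
  have hn := totalDegree_lt_of_mem_degreeLT h h0
  refine mem_degreeLT_totalDegree (lt_of_le_of_lt ?_ hn)
  have hX : ∀ i, (MvPolynomial.X i - MvPolynomial.C (2 / ‖v‖ ^ 2 * v i) * linForm v :
      MvPolynomial (Fin d) ℝ).totalDegree ≤ 1 := fun i => by
    have hm : (MvPolynomial.X i - MvPolynomial.C (2 / ‖v‖ ^ 2 * v i) * linForm v :
        MvPolynomial (Fin d) ℝ) ∈ degreeLT d 2 :=
      Submodule.sub_mem _ (mem_degreeLT_totalDegree (by simp))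
        (C_mul_mem_degreeLT (linForm_mem_degreeLT v) _)
    by_cases h1 : (MvPolynomial.X i - MvPolynomial.C (2 / ‖v‖ ^ 2 * v i) * linForm v :
        MvPolynomial (Fin d) ℝ) = 0
    · rw [h1]; simp
    · exact Nat.lt_succ_iff.mp (totalDegree_lt_of_mem_degreeLT hm h1)
  rw [reflPoly, MvPolynomial.aeval_def, MvPolynomial.eval₂_eq]
  refine MvPolynomial.totalDegree_finsetSum_le fun m hm => ?_
  refine (MvPolynomial.totalDegree_mul _ _).trans ?_
  have h1 : (algebraMap ℝ (MvPolynomial (Fin d) ℝ) (p.coeff m)).totalDegree = 0 := by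
    rw [MvPolynomial.algebraMap_eq, MvPolynomial.totalDegree_C]
  rw [h1, zero_add]
  refine (MvPolynomial.totalDegree_finsetProd _ _).trans ?_
  refine le_trans ?_ (MvPolynomial.le_totalDegree hm)
  refine Finset.sum_le_sum fun i _ => ?_
  refine (MvPolynomial.totalDegree_pow _ _).trans ?_
  simpa using Nat.mul_le_mul_left (m i) (hX i)

theorem dirDeriv_mul (v : EuclideanSpace ℝ (Fin d)) (p q : MvPolynomial (Fin d) ℝ) :
    dirDeriv v (p * q) = dirDeriv v p * q + p * dirDeriv v q := by
  simp only [dirDeriv, MvPolynomial.pderiv_mul, Finset.sum_mul, Finset.mul_sum,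
    ← Finset.sum_add_distrib]
  exact Finset.sum_congr rfl fun i _ => by ring

theorem dirDeriv_add (v : EuclideanSpace ℝ (Fin d)) (p q : MvPolynomial (Fin d) ℝ) :
    dirDeriv v (p + q) = dirDeriv v p + dirDeriv v q := by
  simp [dirDeriv, mul_add, Finset.sum_add_distrib]

theorem dirDeriv_X (v : EuclideanSpace ℝ (Fin d)) (i : Fin d) :
    dirDeriv v (MvPolynomial.X i) = MvPolynomial.C (v i) := by
  simp [dirDeriv, MvPolynomial.pderiv_X, Pi.single_apply]

theorem dirDeriv_C (v : EuclideanSpace ℝ (Fin d)) (c : ℝ) :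
    dirDeriv v (MvPolynomial.C c) = 0 := by
  simp [dirDeriv]

theorem dirDeriv_linForm (v w : EuclideanSpace ℝ (Fin d)) :
    dirDeriv v (linForm w) = MvPolynomial.C ⟪v, w⟫_ℝ := by
  rw [dirDeriv, ← eval_linForm]
  simp_rw [pderiv_linForm]
  simp [linForm, mul_comm]

/-- Chain rule: the reflection reverses the direction `v`. -/
theorem dirDeriv_reflPoly {v : EuclideanSpace ℝ (Fin d)} (hv : v ≠ 0)
    (p : MvPolynomial (Fin d) ℝ) : dirDeriv v (reflPoly v p) = -reflPoly v (dirDeriv v p) := by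
  have hX : ∀ i, dirDeriv v (reflPoly v (MvPolynomial.X i)) = MvPolynomial.C (-(v i)) := fun i => by
    have hv' : ‖v‖ ^ 2 ≠ 0 := by simpa using hv
    rw [reflPoly, MvPolynomial.aeval_X, sub_eq_add_neg, ← neg_mul, ← map_neg, dirDeriv_add,
      dirDeriv_mul, dirDeriv_C, dirDeriv_linForm, dirDeriv_X, real_inner_self_eq_norm_sq, zero_mul,
      zero_add, ← map_mul, ← map_add]
    congr 1
    field_simp
    ring
  induction p using MvPolynomial.induction_on with
  | C a => simp [reflPoly, MvPolynomial.algebraMap_eq, dirDeriv_C]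
  | add p q hp hq => rw [map_add, dirDeriv_add, dirDeriv_add, hp, hq, map_add, neg_add]
  | mul_X p i hp =>
    rw [map_mul, dirDeriv_mul, hp, hX, dirDeriv_mul, dirDeriv_X, map_add, map_mul, map_mul]
    have : reflPoly v (MvPolynomial.C (v i)) = MvPolynomial.C (v i) := by
      simp [reflPoly, MvPolynomial.algebraMap_eq]
    rw [this, map_neg]
    ring

/-- The reflection fixes its mirror, so the difference vanishes there. Divisibility is checked on
the variables and propagates to products by telescoping. -/
theorem linForm_dvd_sub_reflPoly (v : EuclideanSpace ℝ (Fin d)) (p : MvPolynomial (Fin d) ℝ) :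
    linForm v ∣ p - reflPoly v p := by
  induction p using MvPolynomial.induction_on with
  | C a => simp [reflPoly, MvPolynomial.algebraMap_eq]
  | add p q hp hq =>
    rw [map_add, add_sub_add_comm]
    exact dvd_add hp hq
  | mul_X p i hp =>
    have hX : linForm v ∣ MvPolynomial.X i - reflPoly v (MvPolynomial.X i) := by
      rw [reflPoly, MvPolynomial.aeval_X, sub_sub_cancel]
      exact dvd_mul_left _ _
    have : p * MvPolynomial.X i - reflPoly v (p * MvPolynomial.X i) =
        (p - reflPoly v p) * MvPolynomial.X i +
          reflPoly v p * (MvPolynomial.X i - reflPoly v (MvPolynomial.X i)) := by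
      rw [map_mul]; ring
    rw [this]
    exact dvd_add (hp.mul_right _) (hX.mul_left _)

/-- The derivative along `v` of a polynomial invariant under the reflection along `v` is divisible
by the linear form of `v`. -/
theorem linForm_dvd_dirDeriv {v : EuclideanSpace ℝ (Fin d)} (hv : v ≠ 0)
    {p : MvPolynomial (Fin d) ℝ} (hp : reflPoly v p = p) : linForm v ∣ dirDeriv v p := by
  have h := linForm_dvd_sub_reflPoly v (dirDeriv v p)
  have h2 := dirDeriv_reflPoly hv p
  rw [hp] at h2
  -- The derivative of an invariant polynomial is odd under the reflection, so its difference with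
  -- its reflection is twice itself.
  rw [show reflPoly v (dirDeriv v p) = -dirDeriv v p from (neg_eq_iff_eq_neg.mpr h2).symm,
    sub_neg_eq_add] at h
  have h3 : dirDeriv v p = MvPolynomial.C (1 / 2) * (dirDeriv v p + dirDeriv v p) := by
    rw [← two_mul, ← mul_assoc, show (2 : MvPolynomial (Fin d) ℝ) = MvPolynomial.C 2 from
      (map_ofNat MvPolynomial.C 2).symm, ← map_mul]
    norm_num
  rw [h3]
  exact h.mul_left _

theorem mem_degreeLT_of_linForm_mul {v : EuclideanSpace ℝ (Fin d)} (hv : v ≠ 0) {n : ℕ}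
    {q : MvPolynomial (Fin d) ℝ} (h : linForm v * q ∈ degreeLT d n) : q ∈ degreeLT d n := by
  by_cases h0 : q = 0
  · simp [h0]
  have h1 := linForm_ne_zero hv
  have := totalDegree_lt_of_mem_degreeLT h (mul_ne_zero h1 h0)
  rw [MvPolynomial.totalDegree_mul_of_isDomain h1 h0] at this
  exact mem_degreeLT_totalDegree (by lia)

/-! ### The differential operator of the ball -/

/-- The quotient of `⟨v, ∇p⟩` by the linear form of `v` (zero if it is not divisible). -/
noncomputable def radialQuot (v : EuclideanSpace ℝ (Fin d)) (p : MvPolynomial (Fin d) ℝ) :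
    MvPolynomial (Fin d) ℝ :=
  open Classical in if h : linForm v ∣ dirDeriv v p then h.choose else 0

theorem linForm_mul_radialQuot {v : EuclideanSpace ℝ (Fin d)} (hv : v ≠ 0)
    {p : MvPolynomial (Fin d) ℝ} (hp : reflPoly v p = p) :
    linForm v * radialQuot v p = dirDeriv v p := by
  have h := linForm_dvd_dirDeriv hv hp
  rw [radialQuot, dif_pos h]
  exact h.choose_spec.symm

/-- The second order operator `Δp + ∑ 2κ_v ⟨v, ∇p⟩/⟨x, v⟩ - 2λ x·∇p - (x·∇)²p` attached to the
weight `W_{κ,μ}`, on polynomials invariant under the reflections. -/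
noncomputable def ballOp (P : Finset (EuclideanSpace ℝ (Fin d)))
    (κ : EuclideanSpace ℝ (Fin d) → ℝ) (μ : ℝ) (p : MvPolynomial (Fin d) ℝ) :
    MvPolynomial (Fin d) ℝ :=
  ∑ i, MvPolynomial.pderiv i (MvPolynomial.pderiv i p) +
    ∑ v ∈ P, MvPolynomial.C (2 * κ v) * radialQuot v p -
    MvPolynomial.C (2 * lam P κ μ) * euler p - euler (euler p)

/-- Invariance of a polynomial under the reflections in `P`. -/
def IsInvPoly (P : Finset (EuclideanSpace ℝ (Fin d))) (p : MvPolynomial (Fin d) ℝ) : Prop :=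
  ∀ v ∈ P, reflPoly v p = p

/-- The Laplacian and the quotients by linear forms lower the degree; on the part of degree `n` the
Euler terms act as `-2λn - n²`. This is the source of the eigenvalues. -/
theorem ballOp_add_mem_degreeLT {P : Finset (EuclideanSpace ℝ (Fin d))} (hP : ∀ v ∈ P, v ≠ 0)
    (κ : EuclideanSpace ℝ (Fin d) → ℝ) (μ : ℝ) {p : MvPolynomial (Fin d) ℝ}
    (hp : IsInvPoly P p) {n : ℕ} (hn : p ∈ degreeLT d (n + 1)) :
    ballOp P κ μ p + (n * (n + 2 * lam P κ μ)) • p ∈ degreeLT d n := by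
  have h1 : ∑ i, MvPolynomial.pderiv i (MvPolynomial.pderiv i p) ∈ degreeLT d n :=
    Submodule.sum_mem _ fun i _ =>
      pderiv_mem_degreeLT (degreeLT_mono n.le_succ (pderiv_mem_degreeLT hn i)) i
  have h2 : ∑ v ∈ P, MvPolynomial.C (2 * κ v) * radialQuot v p ∈ degreeLT d n := by
    refine Submodule.sum_mem _ fun v hv => C_mul_mem_degreeLT
      (mem_degreeLT_of_linForm_mul (hP v hv) ?_) _
    rw [linForm_mul_radialQuot (hP v hv) (hp v hv)]
    exact Submodule.sum_mem _ fun i _ => C_mul_mem_degreeLT (pderiv_mem_degreeLT hn i) _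
  have h3 := euler_sub_mem_degreeLT hn
  have h4 := euler_mem_degreeLT h3
  -- With `e` the Euler operator, `e² - n² = e(e - n) + n(e - n)`, so every Euler term contains the
  -- degree-lowering `e - n`.
  have h5 : ballOp P κ μ p + (n * (n + 2 * lam P κ μ)) • p =
      ∑ i, MvPolynomial.pderiv i (MvPolynomial.pderiv i p) +
      ∑ v ∈ P, MvPolynomial.C (2 * κ v) * radialQuot v p -
      (2 * lam P κ μ) • (euler p - (n : ℝ) • p) - euler (euler p - (n : ℝ) • p)
      - (n : ℝ) • (euler p - (n : ℝ) • p) := by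
    simp only [ballOp, map_sub, map_smul, ← MvPolynomial.smul_eq_C_mul]
    module
  rw [h5]
  exact Submodule.sub_mem _ (Submodule.sub_mem _ (Submodule.sub_mem _ (Submodule.add_mem _ h1 h2)
    (Submodule.smul_mem _ _ h3)) h4) (Submodule.smul_mem _ _ h3)

theorem ballOp_mem_degreeLT {P : Finset (EuclideanSpace ℝ (Fin d))} (hP : ∀ v ∈ P, v ≠ 0)
    (κ : EuclideanSpace ℝ (Fin d) → ℝ) (μ : ℝ) {p : MvPolynomial (Fin d) ℝ}
    (hp : IsInvPoly P p) {n : ℕ} (hn : p ∈ degreeLT d n) :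
    ballOp P κ μ p ∈ degreeLT d n := by
  have h := ballOp_add_mem_degreeLT hP κ μ hp (degreeLT_mono n.le_succ hn)
  simpa using Submodule.sub_mem _ h
    (Submodule.smul_mem _ (n * (n + 2 * lam P κ μ) : ℝ) hn)

theorem isInvPoly_linForm {P : Finset (EuclideanSpace ℝ (Fin d))} {u : EuclideanSpace ℝ (Fin d)}
    (hu : ∀ v ∈ P, ⟪v, u⟫_ℝ = 0) : IsInvPoly P (linForm u) := by
  intro v hv
  refine MvPolynomial.funext fun x => ?_
  have hx := eval_reflPoly v (WithLp.toLp 2 x) (linForm u)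
  rw [eval_linForm, refl_apply, inner_sub_left, inner_smul_left, hu v hv, mul_zero, sub_zero,
    ← eval_linForm] at hx
  exact hx

theorem euler_linForm (u : EuclideanSpace ℝ (Fin d)) : euler (linForm u) = linForm u := by
  rw [euler_apply]
  simp_rw [pderiv_linForm]
  exact Finset.sum_congr rfl fun i _ => mul_comm _ _

/-- Second derivatives and radial quotients vanish, and the Euler operator fixes a linear form. The
eigenvalue is the case `n = 1` of `n(n+2λ)`, without lower order remainder. -/
theorem ballOp_linForm {P : Finset (EuclideanSpace ℝ (Fin d))} (hP : ∀ v ∈ P, v ≠ 0)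
    (κ : EuclideanSpace ℝ (Fin d) → ℝ) (μ : ℝ) {u : EuclideanSpace ℝ (Fin d)}
    (hu : ∀ v ∈ P, ⟪v, u⟫_ℝ = 0) :
    ballOp P κ μ (linForm u) = -((2 * lam P κ μ + 1) • linForm u) := by
  have h : ∀ v ∈ P, radialQuot v (linForm u) = 0 := fun v hv => by
    have h := linForm_mul_radialQuot (hP v hv) (isInvPoly_linForm hu v hv)
    rw [dirDeriv_linForm, hu v hv, map_zero] at h
    exact (mul_eq_zero.mp h).resolve_left (linForm_ne_zero (hP v hv))
  have h' : ∑ v ∈ P, MvPolynomial.C (2 * κ v) * radialQuot v (linForm u) = 0 :=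
    Finset.sum_eq_zero fun v hv => by rw [h v hv, mul_zero]
  rw [ballOp, h']
  simp only [pderiv_linForm, MvPolynomial.pderiv_C, Finset.sum_const_zero,
    euler_linForm, ← MvPolynomial.smul_eq_C_mul]
  module

/-! ### Polynomials as functions -/

theorem hasFDerivAt_eval (p : MvPolynomial (Fin d) ℝ) (x : EuclideanSpace ℝ (Fin d)) :
    HasFDerivAt (fun y : EuclideanSpace ℝ (Fin d) => MvPolynomial.eval y p)
      (∑ i, MvPolynomial.eval x (MvPolynomial.pderiv i p) •
        (EuclideanSpace.proj i : EuclideanSpace ℝ (Fin d) →L[ℝ] ℝ)) x := by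
  induction p using MvPolynomial.induction_on with
  | C a => simpa using hasFDerivAt_const a x
  | add p q hp hq =>
    simp only [map_add, add_smul, Finset.sum_add_distrib]
    exact hp.add hq
  | mul_X p i hp =>
    have hX : HasFDerivAt (fun y : EuclideanSpace ℝ (Fin d) => y i)
        (EuclideanSpace.proj i : EuclideanSpace ℝ (Fin d) →L[ℝ] ℝ) x :=
      (EuclideanSpace.proj i : EuclideanSpace ℝ (Fin d) →L[ℝ] ℝ).hasFDerivAt
    simp only [map_mul, MvPolynomial.eval_X]
    refine (hp.mul hX).congr_fderiv ?_
    ext y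
    simp [MvPolynomial.pderiv_X, Pi.single_apply, Finset.mul_sum, add_mul, Finset.sum_add_distrib,
      mul_assoc, apply_ite (MvPolynomial.eval x.ofLp)]

theorem fderiv_eval_single (p : MvPolynomial (Fin d) ℝ) (x : EuclideanSpace ℝ (Fin d))
    (i : Fin d) :
    fderiv ℝ (fun y : EuclideanSpace ℝ (Fin d) => MvPolynomial.eval y p) x
      (EuclideanSpace.single i 1) = MvPolynomial.eval x (MvPolynomial.pderiv i p) := by
  rw [(hasFDerivAt_eval p x).fderiv]
  simp

theorem contDiff_eval (p : MvPolynomial (Fin d) ℝ) :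
    ContDiff ℝ ∞ (fun y : EuclideanSpace ℝ (Fin d) => MvPolynomial.eval y p) := by
  induction p using MvPolynomial.induction_on with
  | C a => simpa using contDiff_const
  | add p q hp hq => simpa using hp.add hq
  | mul_X p i hp =>
    simp only [map_mul, MvPolynomial.eval_X]
    exact hp.mul (EuclideanSpace.proj i : EuclideanSpace ℝ (Fin d) →L[ℝ] ℝ).contDiff

theorem continuous_eval (p : MvPolynomial (Fin d) ℝ) :
    Continuous (fun y : EuclideanSpace ℝ (Fin d) => MvPolynomial.eval y p) :=
  (contDiff_eval p).continuous

theorem eval_dirDeriv (v x : EuclideanSpace ℝ (Fin d)) (p : MvPolynomial (Fin d) ℝ) :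
    MvPolynomial.eval x (dirDeriv v p) =
      ∑ i, v i * MvPolynomial.eval x (MvPolynomial.pderiv i p) := by
  simp [dirDeriv]

theorem eval_euler (x : EuclideanSpace ℝ (Fin d)) (p : MvPolynomial (Fin d) ℝ) :
    MvPolynomial.eval x (euler p) =
      ∑ i, x i * MvPolynomial.eval x (MvPolynomial.pderiv i p) := by
  simp [euler_apply]

/-! ### The regular set and the weight -/

/-- Since `0 ^ 0 = 1` for real powers, mirrors of zero multiplicity do not make the weight vanish;
hence the filter. -/
theorem hWeight_ne_zero_iff (P : Finset (EuclideanSpace ℝ (Fin d)))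
    (κ : EuclideanSpace ℝ (Fin d) → ℝ) (x : EuclideanSpace ℝ (Fin d)) :
    hWeight P κ x ≠ 0 ↔ ∀ v ∈ P.filter (κ · ≠ 0), ⟪x, v⟫_ℝ ≠ 0 := by
  rw [hWeight, Finset.prod_ne_zero_iff]
  simp only [Finset.mem_filter, and_imp]
  refine forall₂_congr fun v _ => ?_
  rw [Ne, Real.rpow_eq_zero_iff_of_nonneg (abs_nonneg _), abs_eq_zero, not_and_or, not_not]
  tauto

theorem isOpen_regularSet (P : Finset (EuclideanSpace ℝ (Fin d)))
    (κ : EuclideanSpace ℝ (Fin d) → ℝ) : IsOpen (regularSet P κ) := by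
  have : regularSet P κ = {x | ‖x‖ < 1} ∩ ⋂ v ∈ P.filter (κ · ≠ 0), {x | ⟪x, v⟫_ℝ ≠ 0} := by
    ext x
    simp only [regularSet, hWeight_ne_zero_iff, Set.mem_ofPred_eq, Set.mem_inter_iff,
      Set.mem_iInter]
  rw [this]
  refine (isOpen_lt continuous_norm continuous_const).inter (isOpen_biInter_finset fun v _ => ?_)
  exact isOpen_ne_fun (by fun_prop) continuous_const

theorem one_sub_norm_sq_pos {P : Finset (EuclideanSpace ℝ (Fin d))}
    {κ : EuclideanSpace ℝ (Fin d) → ℝ} {x : EuclideanSpace ℝ (Fin d)} (hx : x ∈ regularSet P κ) :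
    0 < 1 - ‖x‖ ^ 2 := by
  have := hx.1
  nlinarith [norm_nonneg x]

/-- A product of powers of linear forms and of `1 - ‖x‖²`, in exponential form. -/
noncomputable def expWeight (Q : Finset (EuclideanSpace ℝ (Fin d)))
    (c : EuclideanSpace ℝ (Fin d) → ℝ) (c₀ : ℝ) (x : EuclideanSpace ℝ (Fin d)) : ℝ :=
  Real.exp (∑ v ∈ Q, c v * Real.log ⟪x, v⟫_ℝ + c₀ * Real.log (1 - ‖x‖ ^ 2))

/-- The logarithmic gradient of `expWeight`. -/
noncomputable def logGrad (Q : Finset (EuclideanSpace ℝ (Fin d)))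
    (c : EuclideanSpace ℝ (Fin d) → ℝ) (c₀ : ℝ) (x : EuclideanSpace ℝ (Fin d)) :
    EuclideanSpace ℝ (Fin d) →L[ℝ] ℝ :=
  ∑ v ∈ Q, (c v * (⟪x, v⟫_ℝ)⁻¹) • innerSL ℝ v - (2 * c₀ * (1 - ‖x‖ ^ 2)⁻¹) • innerSL ℝ x

theorem contDiffAt_expWeight {Q : Finset (EuclideanSpace ℝ (Fin d))}
    (c : EuclideanSpace ℝ (Fin d) → ℝ) (c₀ : ℝ) {x : EuclideanSpace ℝ (Fin d)}
    (hQ : ∀ v ∈ Q, ⟪x, v⟫_ℝ ≠ 0) (hx : 1 - ‖x‖ ^ 2 ≠ 0) :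
    ContDiffAt ℝ ∞ (expWeight Q c c₀) x := by
  refine ContDiffAt.exp (ContDiffAt.add (ContDiffAt.sum fun v hv => ?_) ?_)
  · exact contDiffAt_const.mul ((contDiffAt_id.inner ℝ contDiffAt_const).log (hQ v hv))
  · exact contDiffAt_const.mul ((contDiffAt_const.sub (contDiffAt_id.norm_sq ℝ)).log hx)

theorem hasFDerivAt_expWeight {Q : Finset (EuclideanSpace ℝ (Fin d))}
    (c : EuclideanSpace ℝ (Fin d) → ℝ) (c₀ : ℝ) {x : EuclideanSpace ℝ (Fin d)}
    (hQ : ∀ v ∈ Q, ⟪x, v⟫_ℝ ≠ 0) (hx : 1 - ‖x‖ ^ 2 ≠ 0) :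
    HasFDerivAt (expWeight Q c c₀) (expWeight Q c c₀ x • logGrad Q c c₀ x) x := by
  have h1 : ∀ v ∈ Q, HasFDerivAt (fun y => c v * Real.log ⟪y, v⟫_ℝ)
      ((c v * (⟪x, v⟫_ℝ)⁻¹) • innerSL ℝ v) x := fun v hv => by
    have h : HasFDerivAt (fun y => ⟪y, v⟫_ℝ) (innerSL ℝ v) x := by
      simp_rw [real_inner_comm v]
      exact (innerSL ℝ v).hasFDerivAt
    rw [mul_smul]
    exact (h.log (hQ v hv)).const_mul (c v)
  have h2 : HasFDerivAt (fun y : EuclideanSpace ℝ (Fin d) => c₀ * Real.log (1 - ‖y‖ ^ 2))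
      (-((2 * c₀ * (1 - ‖x‖ ^ 2)⁻¹) • innerSL ℝ x)) x := by
    have h := (((hasFDerivAt_id x).norm_sq.const_sub 1).log hx).const_mul c₀
    refine h.congr_fderiv ?_
    ext y
    simp
    ring
  have h := ((HasFDerivAt.fun_sum h1).add h2).exp
  rw [← sub_eq_add_neg] at h
  exact h

/-- `Real.log` depends only on the absolute value, so the exponential form holds on both sides of
each mirror and gives smoothness and the logarithmic gradient at once. -/
theorem ballWeight_eq_expWeight {P : Finset (EuclideanSpace ℝ (Fin d))}
    {κ : EuclideanSpace ℝ (Fin d) → ℝ} (μ : ℝ) {x : EuclideanSpace ℝ (Fin d)}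
    (hx : x ∈ regularSet P κ) :
    ballWeight P κ μ x =
      expWeight (P.filter (κ · ≠ 0)) (fun v => 2 * κ v) (μ - 1 / 2) x := by
  have hQ := (hWeight_ne_zero_iff P κ x).mp hx.2
  have h0 : hWeight P κ x = ∏ v ∈ P.filter (κ · ≠ 0), Real.exp (κ v * Real.log ⟪x, v⟫_ℝ) := by
    rw [hWeight, Finset.prod_filter]
    refine Finset.prod_congr rfl fun v hv => ?_
    split_ifs with h
    · rw [Real.rpow_def_of_pos (abs_pos.mpr (hQ v (Finset.mem_filter.mpr ⟨hv, h⟩))), Real.log_abs,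
        mul_comm]
    · rw [not_ne_iff.mp h, Real.rpow_zero]
  rw [ballWeight, expWeight, h0, Real.rpow_def_of_pos (one_sub_norm_sq_pos hx), ← Real.exp_sum,
    sq, ← Real.exp_add, ← Real.exp_add, ← Finset.sum_add_distrib]
  congr 2
  · exact Finset.sum_congr rfl fun v _ => by ring
  · ring

theorem ballWeight_nonneg {P : Finset (EuclideanSpace ℝ (Fin d))}
    {κ : EuclideanSpace ℝ (Fin d) → ℝ} (μ : ℝ) {x : EuclideanSpace ℝ (Fin d)}
    (hx : x ∈ unitBall d) : 0 ≤ ballWeight P κ μ x := by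
  have : ‖x‖ ≤ 1 := by simpa [unitBall] using hx
  exact mul_nonneg (sq_nonneg _) (Real.rpow_nonneg (by nlinarith [norm_nonneg x]) _)

theorem ballWeight_pos {P : Finset (EuclideanSpace ℝ (Fin d))}
    {κ : EuclideanSpace ℝ (Fin d) → ℝ} (μ : ℝ) {x : EuclideanSpace ℝ (Fin d)}
    (hx : x ∈ regularSet P κ) : 0 < ballWeight P κ μ x := by
  rw [ballWeight_eq_expWeight μ hx]
  exact Real.exp_pos _

/-- A function that is positive on the regular set within the ball and not positive outside. -/
noncomputable def defining (P : Finset (EuclideanSpace ℝ (Fin d)))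
    (κ : EuclideanSpace ℝ (Fin d) → ℝ) (x : EuclideanSpace ℝ (Fin d)) : ℝ :=
  (∏ v ∈ P.filter (κ · ≠ 0), ⟪x, v⟫_ℝ ^ 2) * (1 - ‖x‖ ^ 2)

theorem continuous_defining (P : Finset (EuclideanSpace ℝ (Fin d)))
    (κ : EuclideanSpace ℝ (Fin d) → ℝ) : Continuous (defining P κ) := by
  unfold defining
  fun_prop

theorem mem_regularSet_of_defining_pos {P : Finset (EuclideanSpace ℝ (Fin d))}
    {κ : EuclideanSpace ℝ (Fin d) → ℝ} {x : EuclideanSpace ℝ (Fin d)}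
    (h : 0 < defining P κ x) : x ∈ regularSet P κ := by
  have h0 : 0 ≤ ∏ v ∈ P.filter (κ · ≠ 0), ⟪x, v⟫_ℝ ^ 2 :=
    Finset.prod_nonneg fun _ _ => sq_nonneg _
  have h1 : 0 < 1 - ‖x‖ ^ 2 := by
    by_contra hn
    exact absurd (mul_nonpos_of_nonneg_of_nonpos h0 (not_lt.mp hn)) (not_le.mpr h)
  refine ⟨by nlinarith [norm_nonneg x], (hWeight_ne_zero_iff P κ x).mpr fun v hv hx => ?_⟩
  rw [defining, Finset.prod_eq_zero hv (by rw [hx, sq, mul_zero]), zero_mul] at h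
  exact lt_irrefl _ h

/-- The function used for cutting off has the same shape as the weight, with exponents 2 and 1, so
one computation of logarithmic gradients serves both. -/
theorem defining_eq_expWeight {P : Finset (EuclideanSpace ℝ (Fin d))}
    {κ : EuclideanSpace ℝ (Fin d) → ℝ} {x : EuclideanSpace ℝ (Fin d)}
    (hx : x ∈ regularSet P κ) :
    defining P κ x = expWeight (P.filter (κ · ≠ 0)) (fun _ => 2) 1 x := by
  have hQ := (hWeight_ne_zero_iff P κ x).mp hx.2
  rw [defining, expWeight, Real.exp_add, one_mul, Real.exp_log (one_sub_norm_sq_pos hx),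
    Real.exp_sum]
  congr 1
  refine Finset.prod_congr rfl fun v hv => ?_
  rw [mul_comm, ← Real.log_abs, ← Real.rpow_def_of_pos (abs_pos.mpr (hQ v hv)), Real.rpow_ofNat,
    sq_abs]

theorem defining_pos {P : Finset (EuclideanSpace ℝ (Fin d))}
    {κ : EuclideanSpace ℝ (Fin d) → ℝ} {x : EuclideanSpace ℝ (Fin d)}
    (hx : x ∈ regularSet P κ) : 0 < defining P κ x := by
  rw [defining_eq_expWeight hx]
  exact Real.exp_pos _

theorem contDiff_defining (P : Finset (EuclideanSpace ℝ (Fin d)))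
    (κ : EuclideanSpace ℝ (Fin d) → ℝ) : ContDiff ℝ ∞ (defining P κ) := by
  refine ContDiff.mul (contDiff_prod fun v _ => ?_) (contDiff_const.sub (contDiff_id.norm_sq ℝ))
  exact (contDiff_id.inner ℝ contDiff_const).pow 2

theorem contDiffAt_ballWeight {P : Finset (EuclideanSpace ℝ (Fin d))}
    {κ : EuclideanSpace ℝ (Fin d) → ℝ} (μ : ℝ) {x : EuclideanSpace ℝ (Fin d)}
    (hx : x ∈ regularSet P κ) : ContDiffAt ℝ ∞ (ballWeight P κ μ) x := by
  refine (contDiffAt_expWeight (fun v => 2 * κ v) (μ - 1 / 2)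
    ((hWeight_ne_zero_iff P κ x).mp hx.2) (one_sub_norm_sq_pos hx).ne').congr_of_eventuallyEq ?_
  filter_upwards [(isOpen_regularSet P κ).mem_nhds hx] with y hy
    using ballWeight_eq_expWeight μ hy

theorem hasFDerivAt_ballWeight {P : Finset (EuclideanSpace ℝ (Fin d))}
    {κ : EuclideanSpace ℝ (Fin d) → ℝ} (μ : ℝ) {x : EuclideanSpace ℝ (Fin d)}
    (hx : x ∈ regularSet P κ) : HasFDerivAt (ballWeight P κ μ)
      (ballWeight P κ μ x •
        logGrad (P.filter (κ · ≠ 0)) (fun v => 2 * κ v) (μ - 1 / 2) x) x := by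
  rw [ballWeight_eq_expWeight μ hx]
  refine (hasFDerivAt_expWeight (fun v => 2 * κ v) (μ - 1 / 2)
    ((hWeight_ne_zero_iff P κ x).mp hx.2) (one_sub_norm_sq_pos hx).ne').congr_of_eventuallyEq ?_
  filter_upwards [(isOpen_regularSet P κ).mem_nhds hx] with y hy
    using ballWeight_eq_expWeight μ hy

theorem hasFDerivAt_defining {P : Finset (EuclideanSpace ℝ (Fin d))}
    {κ : EuclideanSpace ℝ (Fin d) → ℝ} {x : EuclideanSpace ℝ (Fin d)}
    (hx : x ∈ regularSet P κ) : HasFDerivAt (defining P κ)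
      (defining P κ x • logGrad (P.filter (κ · ≠ 0)) (fun _ => 2) 1 x) x := by
  rw [defining_eq_expWeight hx]
  refine (hasFDerivAt_expWeight (fun _ => 2) 1
    ((hWeight_ne_zero_iff P κ x).mp hx.2) (one_sub_norm_sq_pos hx).ne').congr_of_eventuallyEq ?_
  filter_upwards [(isOpen_regularSet P κ).mem_nhds hx] with y hy using defining_eq_expWeight hy

/-! ### The vector field attached to a polynomial -/

/-- The components of `∇p - (x·∇p) x`. -/
noncomputable def ballField (p : MvPolynomial (Fin d) ℝ) (i : Fin d) : MvPolynomial (Fin d) ℝ :=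
  MvPolynomial.pderiv i p - MvPolynomial.X i * euler p

theorem sum_pderiv_ballField (p : MvPolynomial (Fin d) ℝ) :
    ∑ i, MvPolynomial.pderiv i (ballField p i) =
      ∑ i, MvPolynomial.pderiv i (MvPolynomial.pderiv i p) - (d : MvPolynomial (Fin d) ℝ) * euler p
        - euler (euler p) := by
  simp only [ballField, map_sub, MvPolynomial.pderiv_mul, MvPolynomial.pderiv_X_self, one_mul,
    Finset.sum_sub_distrib, Finset.sum_add_distrib, Finset.sum_const, Finset.card_univ,
    Fintype.card_fin, nsmul_eq_mul]
  rw [euler_apply (euler p), sub_add_eq_sub_sub]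

/-- Tangency of the field `∇p - (x·∇p)x`: its product with a root `v` is divisible by `⟨x, v⟩`
because `p` is invariant, and its product with `x` contains the factor `1 - ‖x‖²`. The poles of the
logarithmic gradient therefore cancel and a polynomial, bounded on the ball, remains. -/
theorem sum_logGrad_mul_ballField {Q : Finset (EuclideanSpace ℝ (Fin d))}
    (hQ0 : ∀ v ∈ Q, v ≠ 0) (c : EuclideanSpace ℝ (Fin d) → ℝ) (c₀ : ℝ)
    {x : EuclideanSpace ℝ (Fin d)} (hQ : ∀ v ∈ Q, ⟪x, v⟫_ℝ ≠ 0) (hx : 1 - ‖x‖ ^ 2 ≠ 0)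
    {p : MvPolynomial (Fin d) ℝ} (hp : IsInvPoly Q p) :
    ∑ i, logGrad Q c c₀ x (EuclideanSpace.single i 1) * MvPolynomial.eval x (ballField p i) =
      MvPolynomial.eval x (∑ v ∈ Q, MvPolynomial.C (c v) * (radialQuot v p - euler p) -
        MvPolynomial.C (2 * c₀) * euler p) := by
  have hv : ∀ v ∈ Q, ∑ i, v i * MvPolynomial.eval x (ballField p i) =
      ⟪x, v⟫_ℝ * (MvPolynomial.eval x (radialQuot v p) - MvPolynomial.eval x (euler p)) := by
    intro v hv
    have h := congrArg (MvPolynomial.eval x) (linForm_mul_radialQuot (hQ0 v hv) (hp v hv))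
    rw [map_mul, eval_linForm, eval_dirDeriv] at h
    rw [mul_sub, h]
    simp only [ballField, map_sub, map_mul, MvPolynomial.eval_X, mul_sub, Finset.sum_sub_distrib,
      PiLp.inner_apply, Finset.sum_mul]
    congr 1
    exact Finset.sum_congr rfl fun i _ => by simp; ring
  have hx' : ∑ i, x i * MvPolynomial.eval x (ballField p i) =
      (1 - ‖x‖ ^ 2) * MvPolynomial.eval x (euler p) := by
    simp only [ballField, map_sub, map_mul, MvPolynomial.eval_X, mul_sub, Finset.sum_sub_distrib,
      ← eval_euler, EuclideanSpace.real_norm_sq_eq, sub_mul, one_mul, Finset.sum_mul]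
    congr 1
    exact Finset.sum_congr rfl fun i _ => by ring
  have hl : ∀ i, logGrad Q c c₀ x (EuclideanSpace.single i 1) =
      ∑ v ∈ Q, (c v * (⟪x, v⟫_ℝ)⁻¹) * v i - 2 * c₀ * (1 - ‖x‖ ^ 2)⁻¹ * x i := fun i => by
    simp [logGrad, EuclideanSpace.inner_single_right]
  simp only [hl, sub_mul, Finset.sum_sub_distrib, Finset.sum_mul]
  rw [Finset.sum_comm]
  simp only [map_sub, map_sum, map_mul, MvPolynomial.eval_C]
  congr 1
  · refine Finset.sum_congr rfl fun v hvQ => ?_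
    simp only [mul_assoc, ← Finset.mul_sum]
    rw [hv v hvQ, inv_mul_cancel_left₀ (hQ v hvQ)]
  · simp only [mul_assoc, ← Finset.mul_sum]
    rw [hx', inv_mul_cancel_left₀ hx]

/-! ### Green's identity -/

/-- A smooth step, zero on `(-∞, 1]` and one on `[2, ∞)`. -/
noncomputable def step (t : ℝ) : ℝ := Real.smoothTransition (t - 1)

theorem contDiff_step : ContDiff ℝ ∞ step :=
  Real.smoothTransition.contDiff.comp (contDiff_id.sub contDiff_const)

theorem step_of_le {t : ℝ} (h : t ≤ 1) : step t = 0 :=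
  Real.smoothTransition.zero_of_nonpos (by linarith)

theorem step_of_ge {t : ℝ} (h : 2 ≤ t) : step t = 1 :=
  Real.smoothTransition.one_of_one_le (by linarith)

theorem abs_step_le (t : ℝ) : |step t| ≤ 1 :=
  abs_le.mpr ⟨neg_one_lt_zero.le.trans (Real.smoothTransition.nonneg _),
    Real.smoothTransition.le_one _⟩

theorem deriv_step_of_lt {t : ℝ} (h : t < 1) : deriv step t = 0 := by
  have : step =ᶠ[nhds t] fun _ => 0 := by
    filter_upwards [Iio_mem_nhds h] with s hs using step_of_le (le_of_lt hs)
  rw [this.deriv_eq, deriv_const]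

theorem deriv_step_of_gt {t : ℝ} (h : 2 < t) : deriv step t = 0 := by
  have : step =ᶠ[nhds t] fun _ => 1 := by
    filter_upwards [Ioi_mem_nhds h] with s hs using step_of_ge (le_of_lt hs)
  rw [this.deriv_eq, deriv_const]

/-- The derivative of `step (n * D)` is `n * D * step'(n * D)` times the logarithmic gradient of
`D`; this bounds the scalar factor uniformly in `n`. -/
theorem exists_bound_mul_deriv_step : ∃ M, ∀ t, |t * deriv step t| ≤ M := by
  have hc : Continuous fun t => t * deriv step t :=
    continuous_id.mul (contDiff_step.continuous_deriv (by simp))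
  refine HasCompactSupport.exists_bound_of_continuous (f := fun t => t * deriv step t) ?_ hc
  refine HasCompactSupport.intro (isCompact_Icc (a := (1 : ℝ)) (b := 2)) fun t ht => ?_
  rcases lt_or_ge t 1 with h | h
  · rw [deriv_step_of_lt h, mul_zero]
  · rw [deriv_step_of_gt (not_le.mp fun h' => ht ⟨h, h'⟩), mul_zero]

/-- The weight times a polynomial, cut off near the boundary of the regular set. -/
noncomputable def cutoff (P : Finset (EuclideanSpace ℝ (Fin d)))
    (κ : EuclideanSpace ℝ (Fin d) → ℝ) (μ : ℝ) (n : ℕ) (b : MvPolynomial (Fin d) ℝ)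
    (x : EuclideanSpace ℝ (Fin d)) : ℝ :=
  step (n * defining P κ x) * (ballWeight P κ μ x * MvPolynomial.eval x b)

section cutoff

variable (P : Finset (EuclideanSpace ℝ (Fin d))) (κ : EuclideanSpace ℝ (Fin d) → ℝ) (μ : ℝ)
  (n : ℕ) (b : MvPolynomial (Fin d) ℝ)

theorem tsupport_cutoff : tsupport (cutoff P κ μ n b) ⊆
    {x | 1 ≤ n * defining P κ x} ∩ Metric.closedBall 0 1 := by
  have hcl : IsClosed ({x | 1 ≤ n * defining P κ x} ∩ Metric.closedBall 0 1) :=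
    (isClosed_le continuous_const (continuous_const.mul (continuous_defining P κ))).inter
      Metric.isClosed_closedBall
  refine closure_minimal (fun x hx => ?_) hcl
  have h1 : 1 < n * defining P κ x := by
    by_contra hn
    exact hx (by rw [cutoff, step_of_le (not_lt.mp hn), zero_mul])
  have h2 : 0 < defining P κ x :=
    pos_of_mul_pos_right (zero_lt_one.trans h1) n.cast_nonneg
  exact ⟨h1.le, mem_closedBall_zero_iff.mpr (mem_regularSet_of_defining_pos h2).1.le⟩

theorem tsupport_cutoff_subset : tsupport (cutoff P κ μ n b) ⊆ regularSet P κ := by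
  refine (tsupport_cutoff P κ μ n b).trans fun x hx => mem_regularSet_of_defining_pos ?_
  exact pos_of_mul_pos_right (zero_lt_one.trans_le hx.1) n.cast_nonneg

theorem hasCompactSupport_cutoff : HasCompactSupport (cutoff P κ μ n b) :=
  (isCompact_closedBall (0 : EuclideanSpace ℝ (Fin d)) 1).of_isClosed_subset (isClosed_tsupport _)
    ((tsupport_cutoff P κ μ n b).trans Set.inter_subset_right)

/-- The weight may be singular at the sphere and only finitely smooth at the mirrors, but the cutoff
vanishes near both, so the product is an admissible test function. -/
theorem contDiff_cutoff : ContDiff ℝ ∞ (cutoff P κ μ n b) := by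
  rw [contDiff_iff_contDiffAt]
  intro x
  by_cases hx : x ∈ regularSet P κ
  · exact (contDiff_step.comp (contDiff_const.mul (contDiff_defining P κ))).contDiffAt.mul
      ((contDiffAt_ballWeight μ hx).mul (contDiff_eval b).contDiffAt)
  · have hx' : x ∉ tsupport (cutoff P κ μ n b) := fun h => hx (tsupport_cutoff_subset P κ μ n b h)
    exact contDiffAt_const.congr_of_eventuallyEq (notMem_tsupport_iff_eventuallyEq.mp hx')

variable {P κ}

theorem fderiv_cutoff {x : EuclideanSpace ℝ (Fin d)} (hx : x ∈ regularSet P κ) (i : Fin d) :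
    fderiv ℝ (cutoff P κ μ n b) x (EuclideanSpace.single i 1) =
      ballWeight P κ μ x * (step (n * defining P κ x) *
        (logGrad (P.filter (κ · ≠ 0)) (fun v => 2 * κ v) (μ - 1 / 2) x
          (EuclideanSpace.single i 1) * MvPolynomial.eval x b +
          MvPolynomial.eval x (MvPolynomial.pderiv i b)) +
        (n * defining P κ x) * deriv step (n * defining P κ x) *
          (logGrad (P.filter (κ · ≠ 0)) (fun _ => 2) 1 x (EuclideanSpace.single i 1) *
            MvPolynomial.eval x b)) := by
  have h1 : HasFDerivAt (fun y => step (n * defining P κ y)) _ x :=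
    ((contDiff_step.differentiable (by simp) _).hasDerivAt.comp_hasFDerivAt x
      ((hasFDerivAt_defining hx).const_mul (n : ℝ)))
  have h2 := (hasFDerivAt_ballWeight μ hx).mul (hasFDerivAt_eval b x)
  have h3 := (h1.mul h2).fderiv
  have h4 := fderiv_eval_single b x i
  rw [(hasFDerivAt_eval b x).fderiv] at h4
  have h5 : cutoff P κ μ n b = (fun y => step (n * defining P κ y)) *
    (ballWeight P κ μ * fun y : EuclideanSpace ℝ (Fin d) => MvPolynomial.eval y b) := rfl
  rw [h5, h3]
  simp only [add_apply, smul_apply, h4, smul_eq_mul, Pi.mul_apply]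
  ring

end cutoff

theorem integrableOn_smul_of_tsupport_subset {E V : Type*} [NormedAddCommGroup E]
    [MeasurableSpace E] [BorelSpace E] [NormedAddCommGroup V] [NormedSpace ℝ V]
    {ν : Measure E} {Ω : Set E} {f : E → V} (hf : LocallyIntegrableOn f Ω ν) {φ : E → ℝ}
    (hφ : Continuous φ) (hc : HasCompactSupport φ) (hs : tsupport φ ⊆ Ω) :
    IntegrableOn (fun x => φ x • f x) Ω ν := by
  have h1 : IntegrableOn (fun x => φ x • f x) (tsupport φ) ν :=
    (hf.integrableOn_compact_subset hs hc).continuousOn_smul hφ.continuousOn hc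
  refine ((integrableOn_iff_integrable_of_support_subset ?_).mp h1).integrableOn
  exact fun x hx => subset_tsupport φ fun h0 => hx (by simp only [h0, zero_smul])

theorem exists_bound_eval (p : MvPolynomial (Fin d) ℝ) :
    ∃ M, 0 ≤ M ∧ ∀ x ∈ unitBall d, |MvPolynomial.eval x p| ≤ M := by
  obtain ⟨M, hM⟩ := (isCompact_closedBall (0 : EuclideanSpace ℝ (Fin d)) 1).exists_bound_of_continuousOn
    (continuous_eval p).continuousOn
  exact ⟨M, (norm_nonneg _).trans (hM 0 (by simp)), hM⟩

theorem regularSet_subset_unitBall (P : Finset (EuclideanSpace ℝ (Fin d)))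
    (κ : EuclideanSpace ℝ (Fin d) → ℝ) : regularSet P κ ⊆ unitBall d := fun _ hx =>
  mem_closedBall_zero_iff.mpr hx.1.le

/-- The coefficient of the Euler term collects `-2γ` from the linear forms, `-(2μ - 1)` from `1 -
‖x‖²` and `-d` from the divergence of `x`; together they are `-2λ`. Roots of zero multiplicity
contribute nothing and may be restored to the sum. -/
theorem sum_fderiv_cutoff_ballField {P : Finset (EuclideanSpace ℝ (Fin d))}
    (hP : ∀ v ∈ P, v ≠ 0) {κ : EuclideanSpace ℝ (Fin d) → ℝ} (μ : ℝ) (n : ℕ)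
    {p : MvPolynomial (Fin d) ℝ} (hp : IsInvPoly P p) {x : EuclideanSpace ℝ (Fin d)}
    (hx : x ∈ regularSet P κ) :
    ∑ i, fderiv ℝ (cutoff P κ μ n (ballField p i)) x (EuclideanSpace.single i 1) =
      ballWeight P κ μ x * (step (n * defining P κ x) * MvPolynomial.eval x (ballOp P κ μ p) +
        (n * defining P κ x) * deriv step (n * defining P κ x) * MvPolynomial.eval x
          (∑ v ∈ P.filter (κ · ≠ 0), MvPolynomial.C 2 * (radialQuot v p - euler p) -
            MvPolynomial.C (2 * 1) * euler p)) := by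
  have hQ := (hWeight_ne_zero_iff P κ x).mp hx.2
  have hQ0 : ∀ v ∈ P.filter (κ · ≠ 0), v ≠ 0 := fun v hv => hP v (Finset.mem_filter.mp hv).1
  have hpQ : IsInvPoly (P.filter (κ · ≠ 0)) p := fun v hv => hp v (Finset.mem_filter.mp hv).1
  have hx0 := (one_sub_norm_sq_pos hx).ne'
  simp only [fderiv_cutoff μ n _ hx]
  rw [← Finset.mul_sum, Finset.sum_add_distrib, ← Finset.mul_sum, ← Finset.mul_sum,
    Finset.sum_add_distrib]
  rw [sum_logGrad_mul_ballField hQ0 _ _ hQ hx0 hpQ, sum_logGrad_mul_ballField hQ0 _ _ hQ hx0 hpQ,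
    ← map_sum, sum_pderiv_ballField, ← map_add]
  congr 4
  have h1 : ∑ v ∈ P.filter (κ · ≠ 0), MvPolynomial.C (2 * κ v) * (radialQuot v p - euler p) =
      ∑ v ∈ P, MvPolynomial.C (2 * κ v) * radialQuot v p -
        MvPolynomial.C (2 * ∑ v ∈ P, κ v) * euler p := by
    rw [Finset.sum_filter_of_ne, Finset.mul_sum, map_sum, Finset.sum_mul,
      ← Finset.sum_sub_distrib]
    · exact Finset.sum_congr rfl fun v _ => by ring
    · intro v _ h h0
      exact h (by rw [h0]; simp)
  rw [h1, ballOp, lam]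
  have h2 : (d : MvPolynomial (Fin d) ℝ) = MvPolynomial.C (d : ℝ) := by simp
  rw [h2]
  simp only [← MvPolynomial.smul_eq_C_mul]
  module

/-- **Green's identity** for a weakly differentiable function and an invariant polynomial. -/
theorem integral_ballField_eq {P : Finset (EuclideanSpace ℝ (Fin d))}
    (hP : ∀ v ∈ P, v ≠ 0) {κ : EuclideanSpace ℝ (Fin d) → ℝ} (μ : ℝ)
    {f : EuclideanSpace ℝ (Fin d) → ℝ}
    {g : EuclideanSpace ℝ (Fin d) → EuclideanSpace ℝ (Fin d)}
    (hfg : HasWeakGradient (regularSet P κ) f g)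
    (hf : IntegrableOn (fun x => ballWeight P κ μ x * f x) (regularSet P κ))
    (hg : ∀ i, IntegrableOn (fun x => ballWeight P κ μ x * g x i) (regularSet P κ))
    {p : MvPolynomial (Fin d) ℝ} (hp : IsInvPoly P p) :
    ∫ x in regularSet P κ,
        ballWeight P κ μ x * ∑ i, g x i * MvPolynomial.eval x (ballField p i) =
      -∫ x in regularSet P κ,
        ballWeight P κ μ x * (f x * MvPolynomial.eval x (ballOp P κ μ p)) := by
  set Ω := regularSet P κ with hΩ
  have hΩm : MeasurableSet Ω := (isOpen_regularSet P κ).measurableSet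
  set Q : MvPolynomial (Fin d) ℝ := ∑ v ∈ P.filter (κ · ≠ 0),
    MvPolynomial.C 2 * (radialQuot v p - euler p) - MvPolynomial.C (2 * 1) * euler p
  have hgi : ∀ i, LocallyIntegrableOn (fun x => g x i) Ω := fun i x hx => by
    obtain ⟨s, hs, h⟩ := hfg.locallyIntegrable_grad x hx
    exact ⟨s, hs, (EuclideanSpace.proj i : EuclideanSpace ℝ (Fin d) →L[ℝ] ℝ).integrable_comp h⟩
  have hI1 : ∀ (n : ℕ) (i : Fin d), IntegrableOn (fun x =>
      fderiv ℝ (cutoff P κ μ n (ballField p i)) x (EuclideanSpace.single i 1) • f x) Ω :=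
    fun n i => by
      have hd := contDiff_cutoff P κ μ n (ballField p i)
      refine integrableOn_smul_of_tsupport_subset hfg.locallyIntegrable
        ((hd.continuous_fderiv (by simp)).clm_apply continuous_const)
        ((hasCompactSupport_cutoff P κ μ n (ballField p i)).fderiv_apply ℝ _) ?_
      exact (tsupport_fderiv_apply_subset ℝ _).trans (tsupport_cutoff_subset P κ μ n _)
  have hI2 : ∀ (n : ℕ) (i : Fin d), IntegrableOn (fun x =>
      cutoff P κ μ n (ballField p i) x • g x i) Ω := fun n i =>
    integrableOn_smul_of_tsupport_subset (hgi i) (contDiff_cutoff P κ μ n _).continuous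
      (hasCompactSupport_cutoff P κ μ n _) (tsupport_cutoff_subset P κ μ n _)
  -- Definition of the weak gradient, tested with the cut-off weighted components of the field and
  -- summed over the coordinates.
  have hn : ∀ n : ℕ, ∫ x in Ω, ballWeight P κ μ x * f x *
        (step (n * defining P κ x) * MvPolynomial.eval x (ballOp P κ μ p) +
          (n * defining P κ x) * deriv step (n * defining P κ x) * MvPolynomial.eval x Q) =
      -∫ x in Ω, step (n * defining P κ x) *
        (ballWeight P κ μ x * ∑ i, g x i * MvPolynomial.eval x (ballField p i)) := fun n => by
    have h := Finset.sum_congr rfl fun i (_ : i ∈ Finset.univ) =>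
      hfg.integral_eq (cutoff P κ μ n (ballField p i)) (contDiff_cutoff P κ μ n _)
        (hasCompactSupport_cutoff P κ μ n _) (tsupport_cutoff_subset P κ μ n _) i
    rw [Finset.sum_neg_distrib, ← integral_finsetSum _ fun i _ => hI1 n i,
      ← integral_finsetSum _ fun i _ => hI2 n i] at h
    have h' : ∫ x in Ω, step (n * defining P κ x) *
        (ballWeight P κ μ x * ∑ i, g x i * MvPolynomial.eval x (ballField p i)) =
        ∫ x in Ω, ∑ i, cutoff P κ μ n (ballField p i) x • g x i := by
      refine setIntegral_congr_fun hΩm fun x _ => ?_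
      simp only [cutoff, Finset.mul_sum, smul_eq_mul]
      exact Finset.sum_congr rfl fun i _ => by ring
    rw [h', ← h]
    · refine setIntegral_congr_fun hΩm fun x hx => ?_
      simp only [smul_eq_mul, ← Finset.sum_mul]
      rw [sum_fderiv_cutoff_ballField hP μ n hp hx]
      ring
  obtain ⟨M, hM⟩ := exists_bound_mul_deriv_step
  have hM0 : 0 ≤ M := (abs_nonneg _).trans (hM 0)
  obtain ⟨A, hA0, hA⟩ := exists_bound_eval (ballOp P κ μ p)
  obtain ⟨B, hB0, hB⟩ := exists_bound_eval Q
  -- At each fixed point the cutoff is eventually 1 with zero derivative, so the error term vanishes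
  -- pointwise; the uniform bounds above then allow dominated convergence.
  have hlarge : ∀ x ∈ Ω, ∀ᶠ n : ℕ in Filter.atTop, 2 < n * defining P κ x := fun x hx =>
    (tendsto_natCast_atTop_atTop.atTop_mul_const (defining_pos hx)).eventually_gt_atTop 2
  have hstepc : ∀ n : ℕ, Continuous fun x => step (n * defining P κ x) := fun n =>
    contDiff_step.continuous.comp (continuous_const.mul (continuous_defining P κ))
  have hderivc : ∀ n : ℕ, Continuous fun x => deriv step (n * defining P κ x) := fun n =>
    (contDiff_step.continuous_deriv (by simp)).comp
      (continuous_const.mul (continuous_defining P κ))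
  have hL : Filter.Tendsto (fun n : ℕ => ∫ x in Ω, ballWeight P κ μ x * f x *
        (step (n * defining P κ x) * MvPolynomial.eval x (ballOp P κ μ p) +
          (n * defining P κ x) * deriv step (n * defining P κ x) * MvPolynomial.eval x Q))
      Filter.atTop (nhds (∫ x in Ω, ballWeight P κ μ x *
        (f x * MvPolynomial.eval x (ballOp P κ μ p)))) := by
    refine tendsto_integral_of_dominated_convergence
      (fun x => |ballWeight P κ μ x * f x| * (A + M * B)) (fun n => ?_)
      (hf.abs.mul_const _) (fun n => ?_) ?_
    · refine hf.aestronglyMeasurable.mul (Continuous.aestronglyMeasurable ?_)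
      exact ((hstepc n).mul (continuous_eval _)).add
        (((continuous_const.mul (continuous_defining P κ)).mul (hderivc n)).mul (continuous_eval _))
    · filter_upwards [ae_restrict_mem hΩm] with x hx
      have hxb := regularSet_subset_unitBall P κ hx
      rw [Real.norm_eq_abs, abs_mul]
      gcongr
      refine (abs_add_le _ _).trans (add_le_add ?_ ?_)
      · rw [abs_mul, ← one_mul A]
        exact mul_le_mul (abs_step_le _) (hA x hxb) (abs_nonneg _) zero_le_one
      · rw [abs_mul]
        exact mul_le_mul (hM _) (hB x hxb) (abs_nonneg _) hM0
    · filter_upwards [ae_restrict_mem hΩm] with x hx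
      refine tendsto_const_nhds.congr' ?_
      filter_upwards [hlarge x hx] with n hn
      rw [step_of_ge hn.le, deriv_step_of_gt hn]
      ring
  have hR : Filter.Tendsto (fun n : ℕ => -∫ x in Ω, step (n * defining P κ x) *
        (ballWeight P κ μ x * ∑ i, g x i * MvPolynomial.eval x (ballField p i)))
      Filter.atTop (nhds (-∫ x in Ω,
        (ballWeight P κ μ x * ∑ i, g x i * MvPolynomial.eval x (ballField p i)))) := by
    have hG : IntegrableOn (fun x => ballWeight P κ μ x *
        ∑ i, g x i * MvPolynomial.eval x (ballField p i)) Ω := by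
      simp only [Finset.mul_sum]
      refine integrable_finsetSum _ fun i _ => ?_
      obtain ⟨D, _, hD⟩ := exists_bound_eval (ballField p i)
      have h := (hg i).bdd_mul (f := fun x : EuclideanSpace ℝ (Fin d) =>
        MvPolynomial.eval x (ballField p i)) (c := D)
        (continuous_eval (ballField p i)).aestronglyMeasurable (by
          filter_upwards [ae_restrict_mem hΩm] with x hx
          exact hD x (regularSet_subset_unitBall P κ hx))
      refine h.congr (Filter.Eventually.of_forall fun x => ?_)
      simp only
      ring
    refine (tendsto_integral_of_dominated_convergence _ (fun n => ?_) hG.norm (fun n => ?_) ?_).neg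
    · exact (hstepc n).aestronglyMeasurable.mul hG.aestronglyMeasurable
    · refine Filter.Eventually.of_forall fun x => ?_
      rw [norm_mul]
      exact mul_le_of_le_one_left (norm_nonneg _) (abs_step_le _)
    · filter_upwards [ae_restrict_mem hΩm] with x hx
      refine tendsto_const_nhds.congr' ?_
      filter_upwards [hlarge x hx] with n hn
      rw [step_of_ge hn.le, one_mul]
  rw [tendsto_nhds_unique hL ((Filter.tendsto_congr hn).mpr hR), neg_neg]

/-- Polynomials are weakly differentiable. -/
theorem hasWeakGradient_eval (p : MvPolynomial (Fin d) ℝ) {Ω : Set (EuclideanSpace ℝ (Fin d))} :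
    HasWeakGradient Ω (fun x => MvPolynomial.eval x p)
      (fun x => WithLp.toLp 2 fun i => MvPolynomial.eval x (MvPolynomial.pderiv i p)) where
  locallyIntegrable := (continuous_eval p).locallyIntegrable.locallyIntegrableOn Ω
  locallyIntegrable_grad := ((PiLp.continuous_toLp 2 _).comp
    (continuous_pi fun i => continuous_eval (MvPolynomial.pderiv i p))).locallyIntegrable.locallyIntegrableOn Ω
  integral_eq φ hφ hc hs i := by
    have hφd := hφ.differentiable (by simp)
    have h := integral_mul_fderiv_eq_neg_fderiv_mul_of_integrable (μ := volume) (𝕜 := ℝ)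
      (f := φ) (g := fun x : EuclideanSpace ℝ (Fin d) => MvPolynomial.eval x p)
      (v := EuclideanSpace.single i 1) ?_ ?_ ?_ (fun x _ => hφd x)
      (fun x _ => (hasFDerivAt_eval p x).differentiableAt)
    · simp only [fderiv_eval_single] at h
      rw [setIntegral_eq_integral_of_forall_compl_eq_zero,
        setIntegral_eq_integral_of_forall_compl_eq_zero]
      · simp only [smul_eq_mul]
        rw [h, neg_neg]
      · intro x hx
        rw [image_eq_zero_of_notMem_tsupport fun h => hx (hs h), zero_smul]
      · intro x hx
        rw [image_eq_zero_of_notMem_tsupport (f := fun x => fderiv ℝ φ x _) fun h =>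
          hx (hs (tsupport_fderiv_apply_subset ℝ _ h)), zero_smul]
    · exact (((hφ.continuous_fderiv (by simp)).clm_apply continuous_const).mul
        (continuous_eval p)).integrable_of_hasCompactSupport ((hc.fderiv_apply ℝ _).mul_right)
    · simp only [fderiv_eval_single]
      exact (hφ.continuous.mul (continuous_eval _)).integrable_of_hasCompactSupport hc.mul_right
    · exact (hφ.continuous.mul (continuous_eval _)).integrable_of_hasCompactSupport hc.mul_right

/-! ### Invariance of the weight -/

theorem refl_refl (v x : EuclideanSpace ℝ (Fin d)) : refl v (refl v x) = x :=
  Submodule.reflection_reflection _ x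

theorem inner_refl (u x v : EuclideanSpace ℝ (Fin d)) : ⟪refl u x, v⟫_ℝ = ⟪x, refl u v⟫_ℝ := by
  rw [← (refl u).inner_map_map x, refl_refl]

theorem refl_neg (v : EuclideanSpace ℝ (Fin d)) : refl (-v) = refl v := by
  ext1 x
  simp [refl_apply, neg_div]

theorem refl_self {v : EuclideanSpace ℝ (Fin d)} (hv : v ≠ 0) : refl v v = -v := by
  have : ‖v‖ ^ 2 ≠ 0 := by simpa using hv
  rw [refl_apply, real_inner_self_eq_norm_sq, mul_div_assoc, div_self this, mul_one, two_smul]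
  abel

theorem refl_mul_refl_mul_inv (u v : EuclideanSpace ℝ (Fin d)) :
    refl u * refl v * (refl u)⁻¹ = refl (refl u v) := by
  rw [mul_inv_eq_iff_eq_mul]
  ext1 x
  change refl u (refl v x) = refl (refl u v) (refl u x)
  rw [refl_apply v, map_sub, map_smul, refl_apply (refl u v), (refl u).inner_map_map,
    (refl u).norm_map]

theorem IsPositiveRootSystem.ne_zero {P : Finset (EuclideanSpace ℝ (Fin d))}
    (hP : IsPositiveRootSystem P) : ∀ v ∈ P, v ≠ 0 := by
  obtain ⟨R, hR, u, -, hu⟩ := hP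
  exact fun v hv => hR.ne_zero v ((hu v).mp hv).1

/-- A reflection permutes the positive roots up to sign. The sign is lost in the absolute value, and
the multiplicity is unchanged because the reflections in a root and in its image are conjugate. -/
theorem hWeight_refl {P : Finset (EuclideanSpace ℝ (Fin d))} (hP : IsPositiveRootSystem P)
    {κ : EuclideanSpace ℝ (Fin d) → ℝ} (hκ : IsMultiplicity P κ)
    {u : EuclideanSpace ℝ (Fin d)} (hu : u ∈ P) (x : EuclideanSpace ℝ (Fin d)) :
    hWeight P κ (refl u x) = hWeight P κ x := by
  classical
  obtain ⟨R, hR, w, hw0, hw⟩ := hP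
  have hneg : ∀ v ∈ R, -v ∈ R := fun v hv => by
    rw [← refl_self (hR.ne_zero v hv)]
    exact hR.refl_mem v hv v hv
  have hnot : ∀ v ∈ P, -v ∉ P := fun v hv h => by
    have h1 := ((hw v).mp hv).2
    have h2 := ((hw _).mp h).2
    rw [inner_neg_right] at h2
    linarith
  -- Of the two roots `± refl u v`, the positive one.
  let τ : EuclideanSpace ℝ (Fin d) → EuclideanSpace ℝ (Fin d) := fun v =>
    if refl u v ∈ P then refl u v else -refl u v
  have hτ : ∀ v ∈ P, τ v ∈ P := fun v hv => by
    have hR' := hR.refl_mem v ((hw v).mp hv).1 u ((hw u).mp hu).1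
    by_cases h : refl u v ∈ P
    · simp only [τ, if_pos h, h]
    · simp only [τ, if_neg h]
      refine (hw _).mpr ⟨hneg _ hR', ?_⟩
      rw [inner_neg_right, neg_pos]
      exact lt_of_le_of_ne (not_lt.mp fun h' => h ((hw _).mpr ⟨hR', h'⟩)) (hw0 _ hR')
  have hττ : ∀ v ∈ P, τ (τ v) = v := fun v hv => by
    by_cases h : refl u v ∈ P
    · simp only [τ, if_pos h, refl_refl, hv, if_true]
    · simp only [τ, if_neg h, map_neg, refl_refl, hnot v hv, if_false, neg_neg]
  have hκτ : ∀ v ∈ P, κ v = κ (τ v) := fun v hv => by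
    refine hκ.conj v hv _ (hτ v hv) ⟨refl u, Subgroup.subset_closure ⟨u, hu, rfl⟩, ?_⟩
    rw [refl_mul_refl_mul_inv]
    simp only [τ]
    split_ifs
    · rfl
    · rw [refl_neg]
  refine Finset.prod_nbij' τ τ hτ hτ hττ hττ fun v hv => ?_
  rw [inner_refl, ← hκτ v hv]
  congr 1
  simp only [τ]
  split_ifs
  · rfl
  · rw [inner_neg_right, abs_neg]

/-! ### The probability measure attached to the weight -/

/-- The measure with density `b_{κ,μ} W_{κ,μ}` on the ball. -/
noncomputable def ballMeasure (P : Finset (EuclideanSpace ℝ (Fin d)))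
    (κ : EuclideanSpace ℝ (Fin d) → ℝ) (μ : ℝ) : Measure (EuclideanSpace ℝ (Fin d)) :=
  (volume.restrict (regularSet P κ)).withDensity
    fun x => ENNReal.ofReal (normConst P κ μ * ballWeight P κ μ x)

/-- Only points of the sphere and of finitely many hyperplanes are missing. -/
theorem regularSet_ae_eq {P : Finset (EuclideanSpace ℝ (Fin d))} (hP : ∀ v ∈ P, v ≠ 0)
    (κ : EuclideanSpace ℝ (Fin d) → ℝ) : regularSet P κ =ᵐ[volume] unitBall d := by
  refine (regularSet_subset_unitBall P κ).eventuallyLE.antisymm ?_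
  rw [ae_le_set]
  have hsub : unitBall d \ regularSet P κ ⊆ Metric.sphere 0 1 ∪
      ⋃ v ∈ P, (((ℝ ∙ v)ᗮ : Submodule ℝ (EuclideanSpace ℝ (Fin d))) :
        Set (EuclideanSpace ℝ (Fin d))) := by
    rintro x ⟨hx, hn⟩
    have hx1 : ‖x‖ ≤ 1 := mem_closedBall_zero_iff.mp hx
    rcases hx1.eq_or_lt with h1 | h1
    · exact Or.inl (mem_sphere_zero_iff_norm.mpr h1)
    · right
      have : ¬ hWeight P κ x ≠ 0 := fun h => hn ⟨h1, h⟩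
      rw [hWeight_ne_zero_iff] at this
      push Not at this
      obtain ⟨v, hv, h0⟩ := this
      refine Set.mem_biUnion (Finset.mem_filter.mp hv).1 ?_
      rw [SetLike.mem_coe, Submodule.mem_orthogonal_singleton_iff_inner_left]
      exact h0
  refine measure_mono_null hsub (measure_union_null
    (Measure.addHaar_sphere_of_ne_zero _ _ one_ne_zero) ?_)
  refine (measure_biUnion_null_iff P.countable_toSet).mpr fun v hv =>
    Measure.addHaar_submodule _ _ fun h => hP v hv ?_
  have : v ∈ (ℝ ∙ v)ᗮ := h ▸ Submodule.mem_top
  exact inner_self_eq_zero.mp (Submodule.mem_orthogonal_singleton_iff_inner_left.mp this)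

theorem measurable_ballWeight (P : Finset (EuclideanSpace ℝ (Fin d)))
    (κ : EuclideanSpace ℝ (Fin d) → ℝ) (μ : ℝ) : Measurable (ballWeight P κ μ) := by
  unfold ballWeight hWeight
  fun_prop

section measure

variable {P : Finset (EuclideanSpace ℝ (Fin d))} {κ : EuclideanSpace ℝ (Fin d) → ℝ} {μ : ℝ}

theorem normConst_nonneg : 0 ≤ normConst P κ μ :=
  inv_nonneg.mpr (setIntegral_nonneg Metric.isClosed_closedBall.measurableSet
    fun _ hx => ballWeight_nonneg μ hx)

/-- Integrability of the weight need not be proved: otherwise its Bochner integral would be 0 by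
default, and so would `normConst`, which the normalization of `f` excludes. -/
theorem integrableOn_ballWeight (h : normConst P κ μ ≠ 0) :
    IntegrableOn (ballWeight P κ μ) (unitBall d) := by
  by_contra hn
  exact h (by rw [normConst, integral_undef hn, inv_zero])

theorem normConst_pos (h : normConst P κ μ ≠ 0) : 0 < normConst P κ μ :=
  lt_of_le_of_ne normConst_nonneg h.symm

theorem density_nonneg {x : EuclideanSpace ℝ (Fin d)} (hx : x ∈ regularSet P κ) :
    0 ≤ normConst P κ μ * ballWeight P κ μ x :=
  mul_nonneg normConst_nonneg (ballWeight_pos μ hx).le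

theorem integral_ballMeasure {V : Type*} [NormedAddCommGroup V] [NormedSpace ℝ V]
    (F : EuclideanSpace ℝ (Fin d) → V) : ∫ x, F x ∂ballMeasure P κ μ =
      normConst P κ μ • ∫ x in regularSet P κ, ballWeight P κ μ x • F x := by
  rw [ballMeasure, integral_withDensity_eq_integral_toReal_smul
    ((measurable_ballWeight P κ μ).const_mul _).ennreal_ofReal (by simp), ← integral_smul]
  refine setIntegral_congr_fun (isOpen_regularSet P κ).measurableSet fun x hx => ?_
  simp only [ENNReal.toReal_ofReal (density_nonneg hx), mul_smul]

theorem integral_ballMeasure' {V : Type*} [NormedAddCommGroup V] [NormedSpace ℝ V]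
    (hP : ∀ v ∈ P, v ≠ 0) (F : EuclideanSpace ℝ (Fin d) → V) : ∫ x, F x ∂ballMeasure P κ μ =
      normConst P κ μ • ∫ x in unitBall d, ballWeight P κ μ x • F x := by
  rw [integral_ballMeasure, setIntegral_congr_set (regularSet_ae_eq hP κ)]

theorem integrable_ballMeasure (h : normConst P κ μ ≠ 0) {V : Type*} [NormedAddCommGroup V]
    [NormedSpace ℝ V] {F : EuclideanSpace ℝ (Fin d) → V} : Integrable F (ballMeasure P κ μ) ↔
      IntegrableOn (fun x => ballWeight P κ μ x • F x) (regularSet P κ) := by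
  rw [ballMeasure, integrable_withDensity_iff_integrable_smul'
    ((measurable_ballWeight P κ μ).const_mul _).ennreal_ofReal (by simp), IntegrableOn,
    ← integrable_smul_iff h (fun x => ballWeight P κ μ x • F x)]
  refine integrable_congr ?_
  filter_upwards [ae_restrict_mem (isOpen_regularSet P κ).measurableSet] with x hx
  simp only [ENNReal.toReal_ofReal (density_nonneg hx), mul_smul, Pi.smul_apply]

theorem integrable_ballMeasure' (hP : ∀ v ∈ P, v ≠ 0) (h : normConst P κ μ ≠ 0) {V : Type*}
    [NormedAddCommGroup V] [NormedSpace ℝ V] {F : EuclideanSpace ℝ (Fin d) → V} :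
    Integrable F (ballMeasure P κ μ) ↔
      IntegrableOn (fun x => ballWeight P κ μ x • F x) (unitBall d) := by
  rw [integrable_ballMeasure h, integrableOn_congr_set_ae (regularSet_ae_eq hP κ)]

theorem ballMeasure_absolutelyContinuous :
    ballMeasure P κ μ ≪ volume.restrict (regularSet P κ) :=
  withDensity_absolutelyContinuous _ _

theorem absolutelyContinuous_ballMeasure (h : normConst P κ μ ≠ 0) :
    volume.restrict (regularSet P κ) ≪ ballMeasure P κ μ := by
  refine withDensity_absolutelyContinuous'
    ((measurable_ballWeight P κ μ).const_mul _).ennreal_ofReal.aemeasurable ?_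
  filter_upwards [ae_restrict_mem (isOpen_regularSet P κ).measurableSet] with x hx
  exact (ENNReal.ofReal_pos.mpr (mul_pos (normConst_pos h) (ballWeight_pos μ hx))).ne'

theorem ae_mem_regularSet : ∀ᵐ x ∂ballMeasure P κ μ, x ∈ regularSet P κ :=
  ballMeasure_absolutelyContinuous.ae_le
    (ae_restrict_mem (isOpen_regularSet P κ).measurableSet)

theorem ae_mem_unitBall : ∀ᵐ x ∂ballMeasure P κ μ, x ∈ unitBall d :=
  ae_mem_regularSet.mono fun _ hx => regularSet_subset_unitBall P κ hx

theorem isProbabilityMeasure_ballMeasure (hP : ∀ v ∈ P, v ≠ 0) (h : normConst P κ μ ≠ 0) :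
    IsProbabilityMeasure (ballMeasure P κ μ) := by
  refine ⟨?_⟩
  have hi : IntegrableOn (ballWeight P κ μ) (regularSet P κ) :=
    (integrableOn_ballWeight h).mono_set (regularSet_subset_unitBall P κ)
  rw [ballMeasure, withDensity_apply _ MeasurableSet.univ, Measure.restrict_univ,
    ← ofReal_integral_eq_lintegral_ofReal (hi.const_mul _), integral_const_mul,
    setIntegral_congr_set (regularSet_ae_eq hP κ), normConst, inv_mul_cancel₀,
    ENNReal.ofReal_one]
  · exact fun h0 => h (by rw [normConst, h0, inv_zero])
  · filter_upwards [ae_restrict_mem (isOpen_regularSet P κ).measurableSet] with x hx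
    exact density_nonneg hx

theorem measurePreserving_refl (hP : IsPositiveRootSystem P) (hκ : IsMultiplicity P κ)
    {v : EuclideanSpace ℝ (Fin d)} (hv : v ∈ P) :
    MeasurePreserving (refl v) (ballMeasure P κ μ) (ballMeasure P κ μ) := by
  have hvol : MeasurePreserving (refl v) volume volume := (refl v).measurePreserving
  have hpre : refl v ⁻¹' regularSet P κ = regularSet P κ := by
    ext x
    simp only [regularSet, Set.mem_preimage, Set.mem_ofPred_eq, (refl v).norm_map,
      hWeight_refl hP hκ hv]
  have hΩ : MeasurePreserving (refl v) (volume.restrict (regularSet P κ))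
      (volume.restrict (regularSet P κ)) := by
    have := hvol.restrict_preimage (isOpen_regularSet P κ).measurableSet
    rwa [hpre] at this
  refine ⟨hvol.measurable, ?_⟩
  ext s hs
  rw [Measure.map_apply hvol.measurable hs, ballMeasure,
    withDensity_apply _ (hvol.measurable hs), withDensity_apply _ hs,
    ← hΩ.setLIntegral_comp_preimage hs
      ((measurable_ballWeight P κ μ).const_mul _).ennreal_ofReal]
  simp only [ballWeight, hWeight_refl hP hκ hv, (refl v).norm_map]

theorem eq_zero_of_eqOn_isOpen {U : Set (EuclideanSpace ℝ (Fin d))} (hU : IsOpen U)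
    (hne : U.Nonempty) {p : MvPolynomial (Fin d) ℝ}
    (h : ∀ x ∈ U, MvPolynomial.eval x p = 0) : p = 0 := by
  obtain ⟨x, hx⟩ := hne
  have hV : IsOpen (WithLp.toLp 2 ⁻¹' U : Set (Fin d → ℝ)) :=
    hU.preimage (PiLp.continuous_toLp 2 _)
  obtain ⟨ε, hε, hb⟩ := Metric.isOpen_iff.mp hV x.ofLp hx
  rw [ball_pi _ hε] at hb
  refine MvPolynomial.funext_set (fun i => Metric.ball (x i) ε) (fun i => ?_) fun y hy => ?_
  · rw [Real.ball_eq_Ioo]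
    exact Set.Ioo_infinite (by linarith)
  · rw [map_zero]
    exact h _ (hb hy)

/-- The density is positive on a nonempty open set, where a continuous function vanishing almost
everywhere vanishes identically. -/
theorem eq_zero_of_integral_sq_eq_zero (hP : ∀ v ∈ P, v ≠ 0) (h : normConst P κ μ ≠ 0)
    {p : MvPolynomial (Fin d) ℝ}
    (hi : Integrable (fun x : EuclideanSpace ℝ (Fin d) => MvPolynomial.eval x p ^ 2) (ballMeasure P κ μ))
    (hp : ∫ x, MvPolynomial.eval x p ^ 2 ∂ballMeasure P κ μ = 0) : p = 0 := by
  have := isProbabilityMeasure_ballMeasure hP h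
  have h1 := (integral_eq_zero_iff_of_nonneg (fun x => sq_nonneg _) hi).mp hp
  have h2 := (absolutelyContinuous_ballMeasure h).ae_le h1
  have hne : (regularSet P κ).Nonempty := (ae_mem_regularSet (P := P) (κ := κ) (μ := μ)).exists
  refine eq_zero_of_eqOn_isOpen (isOpen_regularSet P κ) hne fun x hx => ?_
  have h3 := Measure.eqOn_open_of_ae_eq h2 (isOpen_regularSet P κ)
    ((continuous_eval p).pow 2).continuousOn continuousOn_const hx
  simpa using h3

end measure

/-! ### Orthogonal projections onto polynomials of bounded degree -/

section projection

variable {ν : Measure (EuclideanSpace ℝ (Fin d))}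

theorem inner_toLp {f g : EuclideanSpace ℝ (Fin d) → ℝ} (hf : MemLp f 2 ν) (hg : MemLp g 2 ν) :
    ⟪hf.toLp f, hg.toLp g⟫_ℝ = ∫ x, f x * g x ∂ν := by
  rw [L2.inner_def]
  refine integral_congr_ae ?_
  filter_upwards [hf.coeFn_toLp, hg.coeFn_toLp] with x h1 h2
  rw [h1, h2, real_inner_eq_re_inner]
  simp [mul_comm]

variable [IsProbabilityMeasure ν]

theorem memLp_of_continuous (hν : ∀ᵐ x ∂ν, x ∈ unitBall d)
    {w : EuclideanSpace ℝ (Fin d) → ℝ} (hw : Continuous w) (p : ENNReal) : MemLp w p ν := by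
  obtain ⟨M, hM⟩ := (isCompact_closedBall (0 : EuclideanSpace ℝ (Fin d)) 1).exists_bound_of_continuousOn
    hw.continuousOn
  exact MemLp.of_bound hw.aestronglyMeasurable M (hν.mono hM)

theorem memLp_eval (hν : ∀ᵐ x ∂ν, x ∈ unitBall d) (p : MvPolynomial (Fin d) ℝ) (r : ENNReal) :
    MemLp (fun x : EuclideanSpace ℝ (Fin d) => MvPolynomial.eval x p) r ν :=
  memLp_of_continuous hν (continuous_eval p) r

/-- Polynomials as elements of `L²`. -/
noncomputable def polyToLp (hν : ∀ᵐ x ∂ν, x ∈ unitBall d) :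
    MvPolynomial (Fin d) ℝ →ₗ[ℝ] Lp ℝ 2 ν where
  toFun p := (memLp_eval hν p 2).toLp
  map_add' p q := by
    rw [← MemLp.toLp_add]
    congr 1
    ext x
    simp
  map_smul' c p := by
    rw [RingHom.id_apply, ← MemLp.toLp_const_smul]
    congr 1
    ext x
    simp [MvPolynomial.smul_eq_C_mul]

theorem exists_orthogonal_projection (hν : ∀ᵐ x ∂ν, x ∈ unitBall d)
    {f : EuclideanSpace ℝ (Fin d) → ℝ} (hf : MemLp f 2 ν) (n : ℕ) :
    ∃ p ∈ degreeLT d n, ∀ q ∈ degreeLT d n,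
      ∫ x, (f x - MvPolynomial.eval x p) * MvPolynomial.eval x q ∂ν = 0 := by
  let K : Submodule ℝ (Lp ℝ 2 ν) := (degreeLT d n).map (polyToLp hν)
  obtain ⟨p, hp, hpe⟩ := (Submodule.mem_map).mp (K.starProjection_apply_mem (hf.toLp f))
  refine ⟨p, hp, fun q hq => ?_⟩
  have h := K.starProjection_inner_eq_zero (hf.toLp f) _ (Submodule.mem_map_of_mem hq)
  rw [← hpe] at h
  have h2 := inner_toLp (hf.sub (memLp_eval hν p 2)) (memLp_eval hν q 2)
  rw [MemLp.toLp_sub hf (memLp_eval hν p 2)] at h2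
  exact h2.symm.trans h

theorem exists_poly_near (w : EuclideanSpace ℝ (Fin d) → ℝ) (hw : Continuous w) {ε : ℝ}
    (hε : 0 < ε) : ∃ q : MvPolynomial (Fin d) ℝ, ∀ x ∈ unitBall d,
      |w x - MvPolynomial.eval x q| ≤ ε := by
  let X := Metric.closedBall (0 : EuclideanSpace ℝ (Fin d)) 1
  have : CompactSpace X := isCompact_iff_compactSpace.mp (isCompact_closedBall _ _)
  let Φ : MvPolynomial (Fin d) ℝ →ₐ[ℝ] C(X, ℝ) :=
    MvPolynomial.aeval fun i => ⟨fun x => x.1 i, by fun_prop⟩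
  have hΦ : ∀ p (x : X), Φ p x = MvPolynomial.eval x.1 p := fun p x => by
    induction p using MvPolynomial.induction_on with
    | C a => simp [Φ]
    | add p q hp hq => simp [hp, hq]
    | mul_X p i hp => simp [hp, Φ]
  have hsep : Φ.range.SeparatesPoints := by
    intro x y hxy
    obtain ⟨i, hi⟩ : ∃ i, x.1 i ≠ y.1 i := by
      by_contra! h
      exact hxy (Subtype.ext (PiLp.ext h))
    refine ⟨Φ (MvPolynomial.X i), ⟨Φ (MvPolynomial.X i), ⟨_, rfl⟩, rfl⟩, ?_⟩
    simpa [hΦ] using hi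
  obtain ⟨⟨_, q, rfl⟩, hq⟩ := ContinuousMap.exists_mem_subalgebra_near_continuous_of_separatesPoints
    Φ.range hsep (fun x : X => w x.1) (by fun_prop) ε hε
  refine ⟨q, fun x hx => ?_⟩
  have := (hq ⟨x, hx⟩).le
  rw [abs_sub_comm]
  simpa [hΦ] using this

/-- Bounded continuous functions are dense in `L²`, and polynomials approximate them uniformly on
the ball by Stone–Weierstrass. -/
theorem exists_poly_integral_le (hν : ∀ᵐ x ∂ν, x ∈ unitBall d)
    {f : EuclideanSpace ℝ (Fin d) → ℝ} (hf : MemLp f 2 ν) {ε : ℝ} (hε : 0 < ε) :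
    ∃ q : MvPolynomial (Fin d) ℝ, ∫ x, (f x - MvPolynomial.eval x q) ^ 2 ∂ν ≤ ε := by
  -- Each of the two approximations costs `δ` in norm, and `(2δ)² = ε`.
  set δ := Real.sqrt ε / 2 with hδ
  have hδ0 : 0 < δ := by positivity
  obtain ⟨w, hw, hwm⟩ := hf.exists_boundedContinuous_eLpNorm_sub_le (by simp)
    (ε := ENNReal.ofReal δ) (by simpa using hδ0)
  obtain ⟨q, hq⟩ := exists_poly_near w w.continuous hδ0
  have hqm := memLp_eval hν q 2
  have h2 : eLpNorm (fun x => w x - MvPolynomial.eval x q) 2 ν ≤ ENNReal.ofReal δ := by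
    have := eLpNorm_le_of_ae_bound (p := 2) (f := fun x => w x - MvPolynomial.eval x q) (C := δ)
      (hν.mono hq)
    simpa using this
  have h3 : ‖(hf.sub hqm).toLp‖ ≤ 2 * δ := by
    have h4 : (hf.sub hqm).toLp = (hf.sub hwm).toLp + (hwm.sub hqm).toLp := by
      rw [← MemLp.toLp_add]
      congr 1
      abel
    rw [h4, two_mul]
    refine (norm_add_le _ _).trans (add_le_add ?_ ?_)
    · rw [Lp.norm_toLp]
      exact ENNReal.toReal_le_of_le_ofReal hδ0.le hw
    · rw [Lp.norm_toLp]
      exact ENNReal.toReal_le_of_le_ofReal hδ0.le h2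
  refine ⟨q, ?_⟩
  have h5 := inner_toLp (hf.sub hqm) (hf.sub hqm)
  rw [real_inner_self_eq_norm_sq] at h5
  simp only [Pi.sub_apply, ← sq] at h5
  rw [← h5]
  calc _ ≤ (2 * δ) ^ 2 := by gcongr
    _ = ε := by rw [hδ, mul_div_cancel₀ _ two_ne_zero, Real.sq_sqrt hε.le]

/-- By Pythagoras, the projection is at least as close to `f` as any polynomial of the same degree
bound; density then gives convergence. -/
theorem tendsto_integral_sub_sq (hν : ∀ᵐ x ∂ν, x ∈ unitBall d)
    {f : EuclideanSpace ℝ (Fin d) → ℝ} (hf : MemLp f 2 ν) {p : ℕ → MvPolynomial (Fin d) ℝ}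
    (hp : ∀ n, p n ∈ degreeLT d n)
    (ho : ∀ n, ∀ q ∈ degreeLT d n,
      ∫ x, (f x - MvPolynomial.eval x (p n)) * MvPolynomial.eval x q ∂ν = 0) :
    Filter.Tendsto (fun n => ∫ x, (f x - MvPolynomial.eval x (p n)) ^ 2 ∂ν) Filter.atTop
      (nhds 0) := by
  rw [Metric.tendsto_atTop]
  intro ε hε
  obtain ⟨q, hq⟩ := exists_poly_integral_le hν hf (half_pos hε)
  refine ⟨q.totalDegree + 1, fun n hn => ?_⟩
  have hqn : q ∈ degreeLT d n := mem_degreeLT_totalDegree (by lia)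
  rw [Real.dist_0_eq_abs, abs_of_nonneg (integral_nonneg fun _ => sq_nonneg _)]
  refine lt_of_le_of_lt (le_trans ?_ hq) (half_lt_self hε)
  have h1 := ho n _ (Submodule.sub_mem _ (hp n) hqn)
  have hfp := hf.sub (memLp_eval hν (p n) 2)
  have hpq := memLp_eval hν (p n - q) 2
  have h2 : ∫ x, (f x - MvPolynomial.eval x q) ^ 2 ∂ν =
      ∫ x, (f x - MvPolynomial.eval x (p n)) ^ 2 ∂ν + (2 *
      ∫ x, (f x - MvPolynomial.eval x (p n)) * MvPolynomial.eval x (p n - q) ∂ν +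
      ∫ x, (MvPolynomial.eval x (p n - q)) ^ 2 ∂ν) := by
    have i1 : Integrable (fun x => (f x - MvPolynomial.eval x (p n)) ^ 2) ν := hfp.integrable_sq
    have i2 : Integrable (fun x => 2 * ((f x - MvPolynomial.eval x (p n)) *
        MvPolynomial.eval x (p n - q))) ν := (hfp.integrable_mul hpq).const_mul 2
    have i3 := hpq.integrable_sq
    rw [← integral_const_mul, ← integral_add i2 i3, ← integral_add (g := fun x => _ + _) i1 (i2.add i3)]
    refine integral_congr_ae (Filter.Eventually.of_forall fun x => ?_)
    simp only [map_sub]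
    ring
  rw [h2, h1, mul_zero, zero_add, le_add_iff_nonneg_right]
  exact integral_nonneg fun _ => sq_nonneg _

/-- An upper bound for a bounded quadratic form passes to `L²` limits. -/
theorem integral_mul_sq_le_of_tendsto (hν : ∀ᵐ x ∂ν, x ∈ unitBall d)
    {f : EuclideanSpace ℝ (Fin d) → ℝ} (hf : MemLp f 2 ν) {p : ℕ → MvPolynomial (Fin d) ℝ}
    (hp : Filter.Tendsto (fun n => ∫ x, (f x - MvPolynomial.eval x (p n)) ^ 2 ∂ν) Filter.atTop
      (nhds 0))
    {w : EuclideanSpace ℝ (Fin d) → ℝ} (hw : Continuous w) {C : ℝ}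
    (hC : ∀ n, ∫ x, w x * MvPolynomial.eval x (p n) ^ 2 ∂ν ≤ C) :
    ∫ x, w x * f x ^ 2 ∂ν ≤ C := by
  obtain ⟨M, hM⟩ := (isCompact_closedBall (0 : EuclideanSpace ℝ (Fin d)) 1).exists_bound_of_continuousOn
    hw.continuousOn
  have hwM : ∀ᵐ x ∂ν, ‖w x‖ ≤ M := hν.mono hM
  have hM0 : 0 ≤ M := (norm_nonneg _).trans (hM 0 (by simp))
  set A := ∫ x, f x ^ 2 ∂ν
  have hA : 0 ≤ A := integral_nonneg fun _ => sq_nonneg _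
  have hδ : ∀ δ : ℝ, 0 < δ → ∫ x, w x * f x ^ 2 ∂ν ≤ C + M * δ * A := fun δ hδ => by
    have hn : ∀ n, ∫ x, w x * f x ^ 2 ∂ν ≤ C + M * δ * A + M * (δ⁻¹ + 1) *
        ∫ x, (f x - MvPolynomial.eval x (p n)) ^ 2 ∂ν := fun n => by
      have hpm := memLp_eval hν (p n) 2
      have i1 := hf.integrable_sq.bdd_mul hw.aestronglyMeasurable hwM
      have i2 := hpm.integrable_sq.bdd_mul hw.aestronglyMeasurable hwM
      have i3 := hf.integrable_sq.const_mul (M * δ)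
      have i4 : Integrable (fun x => M * (δ⁻¹ + 1) * (f x - MvPolynomial.eval x (p n)) ^ 2) ν :=
        (hf.sub hpm).integrable_sq.const_mul (M * (δ⁻¹ + 1))
      calc ∫ x, w x * f x ^ 2 ∂ν ≤ ∫ x, (w x * MvPolynomial.eval x (p n) ^ 2 +
            M * δ * f x ^ 2 + M * (δ⁻¹ + 1) * (f x - MvPolynomial.eval x (p n)) ^ 2) ∂ν := by
            refine integral_mono_ae i1 ((i2.add i3).add i4) ?_
            filter_upwards [hwM] with x hx
            set a := f x
            set b := MvPolynomial.eval x (p n)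
            have h1 : w x * (a ^ 2 - b ^ 2) ≤ M * |a ^ 2 - b ^ 2| :=
              (le_abs_self _).trans (by rw [abs_mul]; gcongr; exact hx)
            -- From `a² - b² = 2a(a-b) - (a-b)²` and Young's inequality with parameter `δ`. The `a²`
            -- part is removed by `δ → 0`, after `n → ∞` has removed the other.
            have h2 : |a ^ 2 - b ^ 2| ≤ δ * a ^ 2 + (δ⁻¹ + 1) * (a - b) ^ 2 := by
              have e1 : δ * a ^ 2 + δ⁻¹ * (a - b) ^ 2 - 2 * (a * (a - b)) =
                  δ⁻¹ * (δ * a - (a - b)) ^ 2 := by field_simp; ring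
              have e2 : δ * a ^ 2 + δ⁻¹ * (a - b) ^ 2 + 2 * (a * (a - b)) =
                  δ⁻¹ * (δ * a + (a - b)) ^ 2 := by field_simp; ring
              have e3 : 0 ≤ δ⁻¹ * (δ * a - (a - b)) ^ 2 := by positivity
              have e4 : 0 ≤ δ⁻¹ * (δ * a + (a - b)) ^ 2 := by positivity
              rw [abs_le]
              constructor <;> nlinarith [sq_nonneg (a - b)]
            have h3 := mul_le_mul_of_nonneg_left h2 hM0
            nlinarith
        _ = ∫ x, w x * MvPolynomial.eval x (p n) ^ 2 ∂ν + M * δ * A + M * (δ⁻¹ + 1) *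
            ∫ x, (f x - MvPolynomial.eval x (p n)) ^ 2 ∂ν := by
            rw [← integral_const_mul, ← integral_const_mul, ← integral_add i2 i3,
              ← integral_add (f := fun x => _ + _) (i2.add i3) i4]
        _ ≤ _ := by gcongr; exact hC n
    have hlim := (hp.const_mul (M * (δ⁻¹ + 1))).const_add (C + M * δ * A)
    rw [mul_zero, add_zero] at hlim
    exact ge_of_tendsto' hlim hn
  refine le_of_forall_pos_le_add fun ε hε => ?_
  -- The added 1 keeps the choice of `δ` below meaningful when `M * A = 0`.
  have hpos : 0 < M * A + 1 := by positivity
  refine (hδ (ε / (M * A + 1)) (by positivity)).trans ?_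
  gcongr
  rw [mul_right_comm, ← mul_div_assoc, div_le_iff₀ hpos]
  nlinarith

end projection

/-! ### The energy form -/

/-- The gradient of a polynomial. -/
noncomputable def polyGrad (p : MvPolynomial (Fin d) ℝ) (x : EuclideanSpace ℝ (Fin d)) :
    EuclideanSpace ℝ (Fin d) :=
  WithLp.toLp 2 fun i => MvPolynomial.eval x (MvPolynomial.pderiv i p)

/-- The quadratic form `⟨a, b⟩ - ⟨x, a⟩⟨x, b⟩`. -/
noncomputable def ballForm (x a b : EuclideanSpace ℝ (Fin d)) : ℝ :=
  ⟪a, b⟫_ℝ - ⟪x, a⟫_ℝ * ⟪x, b⟫_ℝ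

theorem continuous_polyGrad (p : MvPolynomial (Fin d) ℝ) : Continuous (polyGrad p) :=
  (PiLp.continuous_toLp 2 _).comp
    (continuous_pi fun i => continuous_eval (MvPolynomial.pderiv i p))

theorem polyGrad_add (p q : MvPolynomial (Fin d) ℝ) (x : EuclideanSpace ℝ (Fin d)) :
    polyGrad (p + q) x = polyGrad p x + polyGrad q x := by
  ext i
  simp [polyGrad]

theorem polyGrad_sq (p : MvPolynomial (Fin d) ℝ) (x : EuclideanSpace ℝ (Fin d)) :
    polyGrad (p ^ 2) x = (2 * MvPolynomial.eval x p) • polyGrad p x := by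
  ext i
  simp [polyGrad, mul_assoc]

theorem polyGrad_linForm (u x : EuclideanSpace ℝ (Fin d)) : polyGrad (linForm u) x = u := by
  ext i
  simp [polyGrad, pderiv_linForm]

theorem sum_mul_ballField (x a : EuclideanSpace ℝ (Fin d)) (p : MvPolynomial (Fin d) ℝ) :
    ∑ i, a i * MvPolynomial.eval x (ballField p i) = ballForm x a (polyGrad p x) := by
  simp only [ballForm, polyGrad, ballField, PiLp.inner_apply, map_sub, map_mul, eval_euler,
    MvPolynomial.eval_X, mul_sub, Finset.sum_sub_distrib, Finset.sum_mul]
  congr 1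
  · exact Finset.sum_congr rfl fun i _ => by simp [mul_comm]
  · refine Finset.sum_congr rfl fun i _ => ?_
    simp only [RCLike.inner_apply, conj_trivial, mul_comm (x.ofLp _), mul_assoc]

theorem ballForm_comm (x a b : EuclideanSpace ℝ (Fin d)) : ballForm x a b = ballForm x b a := by
  rw [ballForm, ballForm, real_inner_comm, mul_comm]

theorem ballForm_smul_left (x a b : EuclideanSpace ℝ (Fin d)) (c : ℝ) :
    ballForm x (c • a) b = c * ballForm x a b := by
  simp only [ballForm, real_inner_smul_left, real_inner_smul_right]
  ring

theorem ballForm_smul_right (x a b : EuclideanSpace ℝ (Fin d)) (c : ℝ) :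
    ballForm x a (c • b) = c * ballForm x a b := by
  rw [ballForm_comm, ballForm_smul_left, ballForm_comm]

theorem ballForm_add_self (x a b : EuclideanSpace ℝ (Fin d)) :
    ballForm x (a + b) (a + b) = ballForm x a a + 2 * ballForm x a b + ballForm x b b := by
  simp only [ballForm, inner_add_left, inner_add_right, real_inner_comm a b]
  ring

theorem ballForm_sub_self (x a b : EuclideanSpace ℝ (Fin d)) :
    ballForm x (a - b) (a - b) = ballForm x a a - 2 * ballForm x a b + ballForm x b b := by
  simp only [ballForm, inner_sub_left, inner_sub_right, real_inner_comm a b]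
  ring

theorem abs_inner_le_of_mem {x : EuclideanSpace ℝ (Fin d)} (hx : x ∈ unitBall d)
    (a : EuclideanSpace ℝ (Fin d)) : |⟪x, a⟫_ℝ| ≤ ‖a‖ :=
  (abs_real_inner_le_norm x a).trans
    (mul_le_of_le_one_left (norm_nonneg a) (mem_closedBall_zero_iff.mp hx))

theorem ballForm_self_nonneg {x : EuclideanSpace ℝ (Fin d)} (hx : x ∈ unitBall d)
    (a : EuclideanSpace ℝ (Fin d)) : 0 ≤ ballForm x a a := by
  rw [ballForm, real_inner_self_eq_norm_sq, ← sq, sub_nonneg, ← sq_abs]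
  exact pow_le_pow_left₀ (abs_nonneg _) (abs_inner_le_of_mem hx a) 2

theorem abs_ballForm_le {x : EuclideanSpace ℝ (Fin d)} (hx : x ∈ unitBall d)
    (a b : EuclideanSpace ℝ (Fin d)) : |ballForm x a b| ≤ 2 * (‖a‖ * ‖b‖) := by
  rw [ballForm, two_mul]
  refine (abs_sub _ _).trans (add_le_add (abs_real_inner_le_norm a b) ?_)
  rw [abs_mul]
  exact mul_le_mul (abs_inner_le_of_mem hx a) (abs_inner_le_of_mem hx b) (abs_nonneg _)
    (norm_nonneg _)

theorem memLp_polyGrad {ν : Measure (EuclideanSpace ℝ (Fin d))} [IsProbabilityMeasure ν]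
    (hν : ∀ᵐ x ∂ν, x ∈ unitBall d) (p : MvPolynomial (Fin d) ℝ) (r : ENNReal) :
    MemLp (polyGrad p) r ν := by
  obtain ⟨M, hM⟩ := (isCompact_closedBall (0 : EuclideanSpace ℝ (Fin d)) 1).exists_bound_of_continuousOn
    (continuous_polyGrad p).continuousOn
  exact MemLp.of_bound (continuous_polyGrad p).aestronglyMeasurable M (hν.mono hM)

theorem integrable_ballForm {ν : Measure (EuclideanSpace ℝ (Fin d))}
    (hν : ∀ᵐ x ∂ν, x ∈ unitBall d) {g h : EuclideanSpace ℝ (Fin d) → EuclideanSpace ℝ (Fin d)}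
    (hg : MemLp g 2 ν) (hh : MemLp h 2 ν) : Integrable (fun x => ballForm x (g x) (h x)) ν := by
  have hx : AEStronglyMeasurable (fun x : EuclideanSpace ℝ (Fin d) => x) ν :=
    continuous_id.aestronglyMeasurable
  have hg' := hg.aestronglyMeasurable
  have hh' := hh.aestronglyMeasurable
  refine ((hg.norm.integrable_mul hh.norm).const_mul 2).mono'
    ((hg'.inner hh').sub ((hx.inner hg').mul (hx.inner hh'))) ?_
  exact hν.mono fun x hx => abs_ballForm_le hx _ _

theorem integral_ballForm_add_self {ν : Measure (EuclideanSpace ℝ (Fin d))}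
    (hν : ∀ᵐ x ∂ν, x ∈ unitBall d) {g h : EuclideanSpace ℝ (Fin d) → EuclideanSpace ℝ (Fin d)}
    (hg : MemLp g 2 ν) (hh : MemLp h 2 ν) :
    ∫ x, ballForm x (g x + h x) (g x + h x) ∂ν = ∫ x, ballForm x (g x) (g x) ∂ν +
      2 * ∫ x, ballForm x (g x) (h x) ∂ν + ∫ x, ballForm x (h x) (h x) ∂ν := by
  have i1 := integrable_ballForm hν hg hg
  have i2 := (integrable_ballForm hν hg hh).const_mul 2
  simp only [ballForm_add_self]
  rw [integral_add (f := fun x => _ + _) (i1.add i2) (integrable_ballForm hν hh hh),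
    integral_add i1 i2, integral_const_mul]

theorem integral_ballForm_sub_self {ν : Measure (EuclideanSpace ℝ (Fin d))}
    (hν : ∀ᵐ x ∂ν, x ∈ unitBall d) {g h : EuclideanSpace ℝ (Fin d) → EuclideanSpace ℝ (Fin d)}
    (hg : MemLp g 2 ν) (hh : MemLp h 2 ν) :
    ∫ x, ballForm x (g x - h x) (g x - h x) ∂ν = ∫ x, ballForm x (g x) (g x) ∂ν -
      2 * ∫ x, ballForm x (g x) (h x) ∂ν + ∫ x, ballForm x (h x) (h x) ∂ν := by
  have i1 := integrable_ballForm hν hg hg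
  have i2 := (integrable_ballForm hν hg hh).const_mul 2
  simp only [ballForm_sub_self]
  rw [integral_add (f := fun x => _ - _) (i1.sub i2) (integrable_ballForm hν hh hh),
    integral_sub i1 i2, integral_const_mul]

theorem integrable_mul_of_memLp {α : Type*} [MeasurableSpace α] {ν : Measure α} {a b : α → ℝ}
    (ha : MemLp a 2 ν) (hb : MemLp b 2 ν) : Integrable (fun x => a x * b x) ν :=
  ha.integrable_mul hb

theorem integral_add_sq {α : Type*} [MeasurableSpace α] {ν : Measure α} {a b : α → ℝ}
    (ha : MemLp a 2 ν) (hb : MemLp b 2 ν) : ∫ x, (a x + b x) ^ 2 ∂ν =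
      ∫ x, a x ^ 2 ∂ν + 2 * ∫ x, a x * b x ∂ν + ∫ x, b x ^ 2 ∂ν := by
  have i1 := ha.integrable_sq
  have i2 := (integrable_mul_of_memLp ha hb).const_mul 2
  simp only [add_sq, mul_assoc]
  rw [integral_add (f := fun x => _ + _) (i1.add i2) hb.integrable_sq, integral_add i1 i2,
    integral_const_mul]

section energy

variable {P : Finset (EuclideanSpace ℝ (Fin d))} {κ : EuclideanSpace ℝ (Fin d) → ℝ} {μ : ℝ}
  {f : EuclideanSpace ℝ (Fin d) → ℝ} {g : EuclideanSpace ℝ (Fin d) → EuclideanSpace ℝ (Fin d)}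

theorem integral_ballForm_polyGrad (hP : ∀ v ∈ P, v ≠ 0) (hb : normConst P κ μ ≠ 0)
    (hfg : HasWeakGradient (regularSet P κ) f g) (hf : Integrable f (ballMeasure P κ μ))
    (hg : Integrable g (ballMeasure P κ μ)) {p : MvPolynomial (Fin d) ℝ} (hp : IsInvPoly P p) :
    ∫ x, ballForm x (g x) (polyGrad p x) ∂ballMeasure P κ μ =
      -∫ x, f x * MvPolynomial.eval x (ballOp P κ μ p) ∂ballMeasure P κ μ := by
  have hgi : ∀ i, IntegrableOn (fun x => ballWeight P κ μ x * g x i) (regularSet P κ) := fun i =>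
    (EuclideanSpace.proj i : EuclideanSpace ℝ (Fin d) →L[ℝ] ℝ).integrable_comp
      ((integrable_ballMeasure hb).mp hg)
  have h := integral_ballField_eq hP μ hfg ((integrable_ballMeasure hb).mp hf) hgi hp
  simp only [sum_mul_ballField] at h
  rw [integral_ballMeasure, integral_ballMeasure]
  simp only [smul_eq_mul]
  rw [h, mul_neg]

/-- Uniqueness of the projection: the reflected polynomial satisfies the same orthogonality
relations, since the measure, `f` and the degree bound are all preserved by the reflection. -/
theorem isInvPoly_of_orthogonal (hP : IsPositiveRootSystem P) (hκ : IsMultiplicity P κ)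
    (hb : normConst P κ μ ≠ 0) (hf : MemLp f 2 (ballMeasure P κ μ))
    (hinv : ∀ v ∈ P, ∀ᵐ x ∂ballMeasure P κ μ, f (refl v x) = f x) {n : ℕ}
    {p : MvPolynomial (Fin d) ℝ} (hp : p ∈ degreeLT d n)
    (ho : ∀ q ∈ degreeLT d n,
      ∫ x, (f x - MvPolynomial.eval x p) * MvPolynomial.eval x q ∂ballMeasure P κ μ = 0) :
    IsInvPoly P p := by
  intro v hv
  have := isProbabilityMeasure_ballMeasure hP.ne_zero hb
  have hν := ae_mem_unitBall (P := P) (κ := κ) (μ := μ)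
  set q := reflPoly v p - p with hq
  have hqn : q ∈ degreeLT d n := Submodule.sub_mem _ (reflPoly_mem_degreeLT v hp) hp
  -- The test polynomial is the reflection of `q`, so that the change of variables turns it back
  -- into `q` and moves the reflection onto `p`.
  have h1 := ho _ (reflPoly_mem_degreeLT v hqn)
  rw [← (measurePreserving_refl hP hκ hv).integral_comp
    (refl v).toHomeomorph.measurableEmbedding] at h1
  have h2 : ∫ x, (f x - MvPolynomial.eval x (reflPoly v p)) * MvPolynomial.eval x q
      ∂ballMeasure P κ μ = 0 := by
    rw [← h1]
    refine integral_congr_ae ?_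
    filter_upwards [hinv v hv] with x hx
    rw [hx, eval_reflPoly v (refl v x), refl_refl, eval_reflPoly]
  have hqm := memLp_eval hν q 2
  have h3 : ∫ x, MvPolynomial.eval x q ^ 2 ∂ballMeasure P κ μ = 0 := by
    have i1 : Integrable (fun x => (f x - MvPolynomial.eval x p) * MvPolynomial.eval x q)
      (ballMeasure P κ μ) := (hf.sub (memLp_eval hν p 2)).integrable_mul hqm
    have i2 : Integrable (fun x => (f x - MvPolynomial.eval x (reflPoly v p)) *
      MvPolynomial.eval x q) (ballMeasure P κ μ) :=
      (hf.sub (memLp_eval hν (reflPoly v p) 2)).integrable_mul hqm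
    have h4 := integral_sub i1 i2
    rw [ho q hqn, h2, sub_zero] at h4
    rw [← h4]
    refine integral_congr_ae (Filter.Eventually.of_forall fun x => ?_)
    simp only [hq, map_sub]
    ring
  exact sub_eq_zero.mp (eq_zero_of_integral_sq_eq_zero hP.ne_zero hb hqm.integrable_sq h3)

/-- The energy of the projection is at most the energy of the function. -/
theorem energy_projection_le (hP : IsPositiveRootSystem P)
    (hb : normConst P κ μ ≠ 0) (hfg : HasWeakGradient (regularSet P κ) f g)
    (hf : MemLp f 2 (ballMeasure P κ μ)) (hg : MemLp g 2 (ballMeasure P κ μ)) {n : ℕ}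
    {p : MvPolynomial (Fin d) ℝ} (hp : p ∈ degreeLT d n) (hpi : IsInvPoly P p)
    (ho : ∀ q ∈ degreeLT d n,
      ∫ x, (f x - MvPolynomial.eval x p) * MvPolynomial.eval x q ∂ballMeasure P κ μ = 0) :
    ∫ x, ballForm x (polyGrad p x) (polyGrad p x) ∂ballMeasure P κ μ ≤
      ∫ x, ballForm x (g x) (g x) ∂ballMeasure P κ μ := by
  have := isProbabilityMeasure_ballMeasure hP.ne_zero hb
  have hν := ae_mem_unitBall (P := P) (κ := κ) (μ := μ)
  have hpg := memLp_polyGrad hν p 2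
  have hpm := memLp_eval hν p 2
  have hL := memLp_eval hν (ballOp P κ μ p) 2
  have h1 := integral_ballForm_polyGrad hP.ne_zero hb hfg (hf.integrable one_le_two)
    (hg.integrable one_le_two) hpi
  have h2 := integral_ballForm_polyGrad hP.ne_zero hb (hasWeakGradient_eval p)
    (hpm.integrable one_le_two) (hpg.integrable one_le_two) hpi
  -- The operator does not raise the degree, so `f` may be replaced by its projection in Green's
  -- identity: the mixed energy of `f` and `p` equals the energy of `p`.
  have h3 := ho _ (ballOp_mem_degreeLT hP.ne_zero κ μ hpi hp)
  simp only [sub_mul] at h3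
  rw [integral_sub (integrable_mul_of_memLp hf hL) (integrable_mul_of_memLp hpm hL), sub_eq_zero] at h3
  rw [h3, ← h2] at h1
  change _ = ∫ x, ballForm x (polyGrad p x) (polyGrad p x) ∂ballMeasure P κ μ at h1
  have h4 : 0 ≤ ∫ x, ballForm x (g x - polyGrad p x) (g x - polyGrad p x) ∂ballMeasure P κ μ :=
    integral_nonneg_of_ae (hν.mono fun x hx => ballForm_self_nonneg hx _)
  rw [integral_ballForm_sub_self hν hg hpg, h1] at h4
  linarith

theorem lam_nonneg [NeZero d] (hκ : IsMultiplicity P κ) (hμ : 0 ≤ μ) : 0 ≤ lam P κ μ := by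
  have h1 : 0 ≤ ∑ v ∈ P, κ v := Finset.sum_nonneg hκ.nonneg
  have h2 : (1 : ℝ) ≤ d := by exact_mod_cast NeZero.one_le
  rw [lam]
  linarith

/-- The spectral gap for the projections of a function of mean zero. -/
theorem spectral_gap_projection [NeZero d] (hP : IsPositiveRootSystem P) (hκ : IsMultiplicity P κ)
    (hμ : 0 ≤ μ) (hb : normConst P κ μ ≠ 0) (hf : MemLp f 2 (ballMeasure P κ μ))
    (hmean : ∫ x, f x ∂ballMeasure P κ μ = 0) {p : ℕ → MvPolynomial (Fin d) ℝ}
    (hp : ∀ n, p n ∈ degreeLT d n) (hpi : ∀ n, IsInvPoly P (p n))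
    (ho : ∀ n, ∀ q ∈ degreeLT d n,
      ∫ x, (f x - MvPolynomial.eval x (p n)) * MvPolynomial.eval x q ∂ballMeasure P κ μ = 0)
    (n : ℕ) : 2 * lam P κ μ * ∫ x, MvPolynomial.eval x (p n) ^ 2 ∂ballMeasure P κ μ ≤
      ∫ x, ballForm x (polyGrad (p n) x) (polyGrad (p n) x) ∂ballMeasure P κ μ := by
  have := isProbabilityMeasure_ballMeasure hP.ne_zero hb
  have hν := ae_mem_unitBall (P := P) (κ := κ) (μ := μ)
  have hlam : 0 ≤ lam P κ μ := lam_nonneg hκ hμ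
  have hm := fun q => memLp_eval hν q 2
  induction n with
  | zero =>
    rw [degreeLT_zero (hp 0)]
    have : ∀ x : EuclideanSpace ℝ (Fin d), polyGrad (0 : MvPolynomial (Fin d) ℝ) x = 0 := fun x => by
      ext i
      simp [polyGrad]
    simp [this, ballForm]
  | succ n ih =>
    -- The increment has degree at most `n` and is orthogonal to all polynomials of smaller degree.
    set r := p (n + 1) - p n with hr
    have hrn : r ∈ degreeLT d (n + 1) :=
      Submodule.sub_mem _ (hp _) (degreeLT_mono n.le_succ (hp n))
    have hri : IsInvPoly P r := fun v hv => by rw [hr, map_sub, hpi _ v hv, hpi _ v hv]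
    have hro : ∀ q ∈ degreeLT d n,
        ∫ x, MvPolynomial.eval x r * MvPolynomial.eval x q ∂ballMeasure P κ μ = 0 := by
      intro q hq
      have i1 : Integrable (fun x => (f x - MvPolynomial.eval x (p n)) * MvPolynomial.eval x q)
        (ballMeasure P κ μ) := (hf.sub (hm (p n))).integrable_mul (hm q)
      have i2 : Integrable (fun x => (f x - MvPolynomial.eval x (p (n + 1))) *
        MvPolynomial.eval x q) (ballMeasure P κ μ) := (hf.sub (hm _)).integrable_mul (hm q)
      have h := integral_sub i1 i2
      rw [ho n q hq, ho (n + 1) q (degreeLT_mono n.le_succ hq), sub_zero] at h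
      rw [← h]
      refine integral_congr_ae (Filter.Eventually.of_forall fun x => ?_)
      simp only [hr, map_sub]
      ring
    have hpr : p (n + 1) = r + p n := (sub_add_cancel _ _).symm
    -- `r` is orthogonal to `Lr + n(n+2λ)r`, which has smaller degree, so its energy is an exact
    -- multiple of its squared norm.
    have hEr : ∫ x, ballForm x (polyGrad r x) (polyGrad r x) ∂ballMeasure P κ μ =
        n * (n + 2 * lam P κ μ) * ∫ x, MvPolynomial.eval x r ^ 2 ∂ballMeasure P κ μ := by
      have h1 := integral_ballForm_polyGrad hP.ne_zero hb (hasWeakGradient_eval r)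
        ((hm r).integrable one_le_two) ((memLp_polyGrad hν r 2).integrable one_le_two) hri
      have h2 := hro _ (ballOp_add_mem_degreeLT hP.ne_zero κ μ hri hrn)
      have h3 : ∀ x : EuclideanSpace ℝ (Fin d), MvPolynomial.eval x r * MvPolynomial.eval x
          (ballOp P κ μ r + (n * (n + 2 * lam P κ μ)) • r) =
          MvPolynomial.eval x r * MvPolynomial.eval x (ballOp P κ μ r) +
            n * (n + 2 * lam P κ μ) * MvPolynomial.eval x r ^ 2 := fun x => by
        rw [map_add, MvPolynomial.smul_eval]
        ring
      simp only [h3] at h2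
      rw [integral_add (integrable_mul_of_memLp (hm r) (hm _)) ((hm r).integrable_sq.const_mul _),
        integral_const_mul] at h2
      change ∫ x, ballForm x (polyGrad r x) (polyGrad r x) ∂ballMeasure P κ μ = _ at h1
      linarith
    have hErp : ∫ x, ballForm x (polyGrad r x) (polyGrad (p n) x) ∂ballMeasure P κ μ = 0 := by
      have h1 := integral_ballForm_polyGrad hP.ne_zero hb (hasWeakGradient_eval r)
        ((hm r).integrable one_le_two) ((memLp_polyGrad hν r 2).integrable one_le_two) (hpi n)
      rw [hro _ (ballOp_mem_degreeLT hP.ne_zero κ μ (hpi n) (hp n)), neg_zero] at h1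
      exact h1
    have hE : ∫ x, ballForm x (polyGrad (p (n + 1)) x) (polyGrad (p (n + 1)) x)
        ∂ballMeasure P κ μ = ∫ x, ballForm x (polyGrad r x) (polyGrad r x) ∂ballMeasure P κ μ +
        ∫ x, ballForm x (polyGrad (p n) x) (polyGrad (p n) x) ∂ballMeasure P κ μ := by
      simp only [hpr, polyGrad_add]
      rw [integral_ballForm_add_self hν (memLp_polyGrad hν r 2) (memLp_polyGrad hν (p n) 2), hErp,
        mul_zero, add_zero]
    have hS : ∫ x, MvPolynomial.eval x (p (n + 1)) ^ 2 ∂ballMeasure P κ μ =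
        ∫ x, MvPolynomial.eval x r ^ 2 ∂ballMeasure P κ μ +
          ∫ x, MvPolynomial.eval x (p n) ^ 2 ∂ballMeasure P κ μ := by
      simp only [hpr, map_add]
      rw [integral_add_sq (hm r) (hm (p n)), hro _ (hp n), mul_zero, add_zero]
    rw [hE, hS, hEr, mul_add]
    refine add_le_add ?_ ih
    -- The factor `n(n+2λ)` vanishes for `n = 0`, where mean zero makes the constant increment zero.
    -- For `n ≥ 1` it is at least `2λ`; the better `2λ+1` is not used.
    rcases n.eq_zero_or_pos with rfl | hn
    · have hp1 : r = 0 := by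
        obtain ⟨c, hc⟩ := degreeLT_one (hp 1)
        have h1 := ho 1 1 (mem_degreeLT_totalDegree (by simp))
        simp only [hc, map_one, mul_one, MvPolynomial.eval_C] at h1
        rw [integral_sub (hf.integrable one_le_two) (integrable_const c), hmean] at h1
        simp only [integral_const, probReal_univ, one_smul, zero_sub, neg_eq_zero] at h1
        rw [hr, degreeLT_zero (hp 0), hc, h1]
        simp
      simp [hp1]
    · have hn1 : (1 : ℝ) ≤ n := by exact_mod_cast hn
      refine mul_le_mul_of_nonneg_right ?_ (integral_nonneg fun _ => sq_nonneg _)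
      nlinarith

/-- The commutator inequality for polynomials. -/
theorem commutator_poly (hP : IsPositiveRootSystem P)
    (hb : normConst P κ μ ≠ 0) (p : MvPolynomial (Fin d) ℝ)
    {u : EuclideanSpace ℝ (Fin d)} (hu : ∀ v ∈ P, ⟪v, u⟫_ℝ = 0) (hu1 : ‖u‖ ≤ 1) {t : ℝ}
    (ht : 0 < t) :
    ∫ x, ((2 * lam P κ μ + 1) * ⟪x, u⟫_ℝ - t⁻¹ * (1 - ⟪x, u⟫_ℝ ^ 2)) * MvPolynomial.eval x p ^ 2
      ∂ballMeasure P κ μ ≤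
      t * ∫ x, ballForm x (polyGrad p x) (polyGrad p x) ∂ballMeasure P κ μ := by
  have := isProbabilityMeasure_ballMeasure hP.ne_zero hb
  have hν := ae_mem_unitBall (P := P) (κ := κ) (μ := μ)
  have hm := fun q => memLp_eval hν q 2
  -- In Green's identity the invariant polynomial is the linear form, with known eigenvalue, so `p`
  -- itself is not required to be invariant.
  have h1 := integral_ballForm_polyGrad hP.ne_zero hb (hasWeakGradient_eval (p ^ 2))
    ((hm _).integrable one_le_two) ((memLp_polyGrad hν (p ^ 2) 2).integrable one_le_two)
    (isInvPoly_linForm hu)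
  change ∫ x, ballForm x (polyGrad (p ^ 2) x) _ ∂ballMeasure P κ μ = _ at h1
  have h2 : ∫ x, (2 * lam P κ μ + 1) * ⟪x, u⟫_ℝ * MvPolynomial.eval x p ^ 2 ∂ballMeasure P κ μ =
      ∫ x, 2 * MvPolynomial.eval x p * ballForm x (polyGrad p x) u ∂ballMeasure P κ μ := by
    simp only [polyGrad_sq, polyGrad_linForm, ballForm_smul_left] at h1
    rw [h1, ← integral_neg]
    refine integral_congr_ae (Filter.Eventually.of_forall fun x => ?_)
    simp only [ballOp_linForm hP.ne_zero κ μ hu, map_neg, MvPolynomial.smul_eval, eval_linForm,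
      map_pow]
    ring
  have hw : Continuous fun x : EuclideanSpace ℝ (Fin d) => ⟪x, u⟫_ℝ := by fun_prop
  have i1 : Integrable (fun x => (2 * lam P κ μ + 1) * ⟪x, u⟫_ℝ * MvPolynomial.eval x p ^ 2)
      (ballMeasure P κ μ) :=
    (memLp_of_continuous hν ((continuous_const.mul hw).mul ((continuous_eval p).pow 2))
      1).integrable le_rfl
  have i2 : Integrable (fun x => t⁻¹ * (1 - ⟪x, u⟫_ℝ ^ 2) * MvPolynomial.eval x p ^ 2)
      (ballMeasure P κ μ) :=
    (memLp_of_continuous hν ((continuous_const.mul (continuous_const.sub (hw.pow 2))).mul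
      ((continuous_eval p).pow 2)) 1).integrable le_rfl
  have hpg := memLp_polyGrad hν p 2
  have i3 := (integrable_ballForm hν hpg hpg).const_mul t
  have i4 : Integrable (fun x : EuclideanSpace ℝ (Fin d) => 2 * MvPolynomial.eval x p * ballForm x (polyGrad p x) u)
      (ballMeasure P κ μ) := by
    have := integrable_ballForm hν (memLp_polyGrad hν (p ^ 2) 2) (memLp_const u)
    simpa only [polyGrad_sq, ballForm_smul_left] using this
  simp only [sub_mul]
  rw [integral_sub i1 i2, h2, ← integral_const_mul, ← integral_sub i4 i2]
  refine integral_mono_ae (i4.sub i2) i3 ?_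
  filter_upwards [hν] with x hx
  set a := MvPolynomial.eval x p
  -- Completing the square: expanding and dividing by `t` bounds the mixed term by the energy
  -- density and `t⁻¹ * ballForm x u u * a²`.
  have h3 := ballForm_self_nonneg hx (t • polyGrad p x - a • u)
  rw [ballForm_sub_self] at h3
  simp only [ballForm_smul_left, ballForm_smul_right] at h3
  have h4 : ballForm x u u ≤ 1 - ⟪x, u⟫_ℝ ^ 2 := by
    rw [ballForm, real_inner_self_eq_norm_sq, ← sq]
    nlinarith [norm_nonneg u]
  rw [sub_le_iff_le_add]
  have h5 : t⁻¹ * (t * (t * ballForm x (polyGrad p x) (polyGrad p x)) -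
      2 * (t * (a * ballForm x (polyGrad p x) u)) + a * (a * ballForm x u u)) =
      t * ballForm x (polyGrad p x) (polyGrad p x) -
        2 * a * ballForm x (polyGrad p x) u + t⁻¹ * ballForm x u u * a ^ 2 := by
    field_simp
  have h6 : t⁻¹ * ballForm x u u * a ^ 2 ≤ t⁻¹ * (1 - ⟪x, u⟫_ℝ ^ 2) * a ^ 2 := by gcongr
  have h7 := mul_nonneg (inv_nonneg.mpr ht.le) h3
  linarith

/-- The spectral gap and the commutator inequality for an invariant weakly differentiable real
function of mean zero. -/
theorem real_bounds [NeZero d] (hP : IsPositiveRootSystem P) (hκ : IsMultiplicity P κ)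
    (hμ : 0 ≤ μ) (hb : normConst P κ μ ≠ 0) (hfg : HasWeakGradient (regularSet P κ) f g)
    (hf : MemLp f 2 (ballMeasure P κ μ)) (hg : MemLp g 2 (ballMeasure P κ μ))
    (hinv : ∀ v ∈ P, ∀ᵐ x ∂ballMeasure P κ μ, f (refl v x) = f x)
    (hmean : ∫ x, f x ∂ballMeasure P κ μ = 0) :
    ∫ x, 2 * lam P κ μ * f x ^ 2 ∂ballMeasure P κ μ ≤
        ∫ x, ballForm x (g x) (g x) ∂ballMeasure P κ μ ∧
      ∀ u : EuclideanSpace ℝ (Fin d), (∀ v ∈ P, ⟪v, u⟫_ℝ = 0) → ‖u‖ ≤ 1 → ∀ t : ℝ, 0 < t →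
        ∫ x, ((2 * lam P κ μ + 1) * ⟪x, u⟫_ℝ - t⁻¹ * (1 - ⟪x, u⟫_ℝ ^ 2)) * f x ^ 2
          ∂ballMeasure P κ μ ≤ t * ∫ x, ballForm x (g x) (g x) ∂ballMeasure P κ μ := by
  have := isProbabilityMeasure_ballMeasure hP.ne_zero hb
  have hν := ae_mem_unitBall (P := P) (κ := κ) (μ := μ)
  choose p hp ho using fun n => exists_orthogonal_projection hν hf n
  have hpi : ∀ n, IsInvPoly P (p n) := fun n =>
    isInvPoly_of_orthogonal hP hκ hb hf hinv (hp n) (ho n)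
  have hlim := tendsto_integral_sub_sq hν hf hp ho
  have hE : ∀ n, _ := fun n => energy_projection_le hP hb hfg hf hg (hp n) (hpi n) (ho n)
  -- Only the left sides go to the limit. The energies of the projections need not be shown to
  -- converge, since each is at most the energy of `f`.
  refine ⟨integral_mul_sq_le_of_tendsto hν hf hlim continuous_const fun n => ?_,
    fun u hu hu1 t ht => integral_mul_sq_le_of_tendsto hν hf hlim (by fun_prop) fun n => ?_⟩
  · rw [integral_const_mul]
    exact (spectral_gap_projection hP hκ hμ hb hf hmean hp hpi ho n).trans (hE n)
  · exact (commutator_poly hP hb (p n) hu hu1 ht).trans (mul_le_mul_of_nonneg_left (hE n) ht.le)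

end energy

/-! ### From real to complex values -/

section scalars

variable {𝕜 : Type*} [RCLike 𝕜]

/-- The componentwise application of a real linear functional to vectors over `𝕜`. -/
noncomputable def mapVec (L : 𝕜 →L[ℝ] ℝ) :
    EuclideanSpace 𝕜 (Fin d) →L[ℝ] EuclideanSpace ℝ (Fin d) :=
  (EuclideanSpace.equiv (Fin d) ℝ).symm.toContinuousLinearMap ∘L
    ContinuousLinearMap.pi fun i => L ∘L (PiLp.proj (𝕜 := ℝ) 2 (fun _ : Fin d => 𝕜) i)

theorem mapVec_apply (L : 𝕜 →L[ℝ] ℝ) (a : EuclideanSpace 𝕜 (Fin d)) (i : Fin d) :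
    mapVec L a i = L (a i) := rfl

theorem locallyIntegrableOn_clm_comp {E V V' : Type*} [MeasurableSpace E] [TopologicalSpace E]
    [NormedAddCommGroup V] [NormedSpace ℝ V] [NormedAddCommGroup V'] [NormedSpace ℝ V']
    {ν : Measure E} {Ω : Set E} {f : E → V} (hf : LocallyIntegrableOn f Ω ν) (L : V →L[ℝ] V') :
    LocallyIntegrableOn (fun x => L (f x)) Ω ν := fun x hx => by
  obtain ⟨s, hs, h⟩ := hf x hx
  exact ⟨s, hs, L.integrable_comp h⟩

theorem locallyIntegrableOn_apply {Ω : Set (EuclideanSpace ℝ (Fin d))}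
    {g : EuclideanSpace ℝ (Fin d) → EuclideanSpace 𝕜 (Fin d)} (hg : LocallyIntegrableOn g Ω)
    (i : Fin d) : LocallyIntegrableOn (fun x => g x i) Ω :=
  locallyIntegrableOn_clm_comp hg (PiLp.proj (𝕜 := ℝ) 2 (fun _ : Fin d => 𝕜) i)

theorem HasWeakGradient.clm_comp {Ω : Set (EuclideanSpace ℝ (Fin d))}
    {f : EuclideanSpace ℝ (Fin d) → 𝕜}
    {g : EuclideanSpace ℝ (Fin d) → EuclideanSpace 𝕜 (Fin d)} (h : HasWeakGradient Ω f g)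
    (L : 𝕜 →L[ℝ] ℝ) : HasWeakGradient Ω (fun x => L (f x)) (fun x => mapVec L (g x)) where
  locallyIntegrable := locallyIntegrableOn_clm_comp h.locallyIntegrable L
  locallyIntegrable_grad := locallyIntegrableOn_clm_comp h.locallyIntegrable_grad (mapVec L)
  integral_eq φ hφ hc hs i := by
    have h1 := h.integral_eq φ hφ hc hs i
    have i1 := integrableOn_smul_of_tsupport_subset h.locallyIntegrable
      ((hφ.continuous_fderiv (by simp)).clm_apply continuous_const)
      (hc.fderiv_apply ℝ (EuclideanSpace.single i 1))
      ((tsupport_fderiv_apply_subset ℝ _).trans hs)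
    have i2 := integrableOn_smul_of_tsupport_subset
      (locallyIntegrableOn_apply h.locallyIntegrable_grad i) hφ.continuous hc hs
    have h2 := congrArg L h1
    rw [map_neg, ← L.integral_comp_comm i1, ← L.integral_comp_comm i2] at h2
    simpa only [map_smul, mapVec_apply] using h2

/-- The main theorem takes an arbitrary weak gradient, while the Sobolev hypothesis gives some
square integrable one; uniqueness transfers the integrability. -/
theorem HasWeakGradient.ae_eq {Ω : Set (EuclideanSpace ℝ (Fin d))} (hΩ : IsOpen Ω)
    {f : EuclideanSpace ℝ (Fin d) → 𝕜}
    {g g' : EuclideanSpace ℝ (Fin d) → EuclideanSpace 𝕜 (Fin d)} (h : HasWeakGradient Ω f g)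
    (h' : HasWeakGradient Ω f g') : g =ᵐ[volume.restrict Ω] g' := by
  have hi : ∀ i, ∀ᵐ x, x ∈ Ω → g x i - g' x i = 0 := fun i => by
    have l1 := locallyIntegrableOn_apply h.locallyIntegrable_grad i
    have l2 := locallyIntegrableOn_apply h'.locallyIntegrable_grad i
    refine hΩ.ae_eq_zero_of_integral_contDiff_smul_eq_zero (l1.sub l2) fun φ hφ hc hs => ?_
    have i1 := integrableOn_smul_of_tsupport_subset l1 hφ.continuous hc hs
    have i2 := integrableOn_smul_of_tsupport_subset l2 hφ.continuous hc hs
    rw [← setIntegral_eq_integral_of_forall_compl_eq_zero (s := Ω)]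
    · simp only [smul_sub]
      rw [integral_sub i1 i2, sub_eq_zero, ← neg_inj]
      exact (h.integral_eq φ hφ hc hs i).symm.trans (h'.integral_eq φ hφ hc hs i)
    · intro x hx
      rw [image_eq_zero_of_notMem_tsupport fun hx' => hx (hs hx'), zero_smul]
  rw [Filter.EventuallyEq, ae_restrict_iff' hΩ.measurableSet]
  filter_upwards [ae_all_iff.mpr hi] with x hx hxΩ
  ext i
  exact sub_eq_zero.mp (hx i hxΩ)

/-- Lagrange's identity: the full double sum is symmetric with zero diagonal, so it is twice the sum
over `i < j`. -/
theorem sum_lt_sq_eq (x a : EuclideanSpace ℝ (Fin d)) :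
    ∑ i, ∑ j, (if i < j then (x i * a j - x j * a i) ^ 2 else 0) =
      ‖x‖ ^ 2 * ‖a‖ ^ 2 - ⟪x, a⟫_ℝ ^ 2 := by
  have h1 : ∑ i, ∑ j, (x i * a j - x j * a i) ^ 2 =
      ∑ i, ∑ j, (if i < j then (x i * a j - x j * a i) ^ 2 else 0) +
        ∑ i, ∑ j, (if j < i then (x i * a j - x j * a i) ^ 2 else 0) := by
    simp only [← Finset.sum_add_distrib]
    refine Finset.sum_congr rfl fun i _ => Finset.sum_congr rfl fun j _ => ?_
    rcases lt_trichotomy i j with h | rfl | h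
    · simp [h, h.not_gt]
    · simp
    · simp [h, h.not_gt]
  have h2 : ∑ i, ∑ j, (if j < i then (x i * a j - x j * a i) ^ 2 else 0) =
      ∑ i, ∑ j, (if i < j then (x i * a j - x j * a i) ^ 2 else 0) := by
    rw [Finset.sum_comm]
    refine Finset.sum_congr rfl fun i _ => Finset.sum_congr rfl fun j _ => ?_
    split_ifs
    · ring
    · rfl
  have h3 : ∑ i, ∑ j, (x i * a j - x j * a i) ^ 2 =
      2 * (‖x‖ ^ 2 * ‖a‖ ^ 2 - ⟪x, a⟫_ℝ ^ 2) := by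
    have e : ∀ i j, (x i * a j - x j * a i) ^ 2 =
        x i ^ 2 * a j ^ 2 + a i ^ 2 * x j ^ 2 - 2 * ((a i * x i) * (a j * x j)) :=
      fun i j => by ring
    simp only [e, Finset.sum_sub_distrib, Finset.sum_add_distrib, ← Finset.mul_sum,
      ← Finset.sum_mul, EuclideanSpace.real_norm_sq_eq, PiLp.inner_apply, RCLike.inner_apply,
      conj_trivial]
    ring
  linarith

theorem norm_sq_eq_re_add_im (z : 𝕜) :
    ‖z‖ ^ 2 = RCLike.reCLM z ^ 2 + RCLike.imCLM z ^ 2 := by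
  rw [RCLike.norm_sq_eq_def, RCLike.reCLM_apply, RCLike.imCLM_apply, sq, sq]

theorem norm_sq_eq_mapVec (a : EuclideanSpace 𝕜 (Fin d)) :
    ‖a‖ ^ 2 = ‖mapVec RCLike.reCLM a‖ ^ 2 + ‖mapVec RCLike.imCLM a‖ ^ 2 := by
  rw [EuclideanSpace.norm_sq_eq, EuclideanSpace.real_norm_sq_eq, EuclideanSpace.real_norm_sq_eq,
    ← Finset.sum_add_distrib]
  exact Finset.sum_congr rfl fun i _ => norm_sq_eq_re_add_im _

/-- The angular part is `‖x‖²‖a‖² - ⟨x, a⟩²` for each real component `a`; adding `(1 - ‖x‖²)‖a‖²`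
leaves `‖a‖² - ⟨x, a⟩²`. -/
theorem angularGradNorm_sq (g : EuclideanSpace ℝ (Fin d) → EuclideanSpace 𝕜 (Fin d))
    (x : EuclideanSpace ℝ (Fin d)) :
    (1 - ‖x‖ ^ 2) * ‖g x‖ ^ 2 + angularGradNorm g x ^ 2 =
      ballForm x (mapVec RCLike.reCLM (g x)) (mapVec RCLike.reCLM (g x)) +
        ballForm x (mapVec RCLike.imCLM (g x)) (mapVec RCLike.imCLM (g x)) := by
  have h : angularGradNorm g x ^ 2 =
      (‖x‖ ^ 2 * ‖mapVec RCLike.reCLM (g x)‖ ^ 2 - ⟪x, mapVec RCLike.reCLM (g x)⟫_ℝ ^ 2) +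
      (‖x‖ ^ 2 * ‖mapVec RCLike.imCLM (g x)‖ ^ 2 - ⟪x, mapVec RCLike.imCLM (g x)⟫_ℝ ^ 2) := by
    rw [angularGradNorm, Real.sq_sqrt, ← sum_lt_sq_eq, ← sum_lt_sq_eq]
    · simp only [← Finset.sum_add_distrib]
      refine Finset.sum_congr rfl fun i _ => Finset.sum_congr rfl fun j _ => ?_
      split_ifs
      · rw [norm_sq_eq_re_add_im]
        simp [mapVec_apply]
      · rw [add_zero]
    · refine Finset.sum_nonneg fun i _ => Finset.sum_nonneg fun j _ => ?_
      split_ifs <;> positivity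
  rw [h, norm_sq_eq_mapVec (g x), ballForm, ballForm, real_inner_self_eq_norm_sq,
    real_inner_self_eq_norm_sq]
  ring

end scalars

/-! ### The scalar inequality -/

/-- Two lower bounds for `(1-τ)E` compete: `2l(1-τ)`, decreasing in `τ`, and `(l+1/2)²τ²/(1+τ)`,
increasing for `τ > 0`. They coincide at `τ = s`. -/
theorem scalar_uncertainty {l E τ : ℝ} (hl : 0 ≤ l) (hE : 2 * l ≤ E) (hτ : τ ≤ 1)
    (h : ∀ t : ℝ, 0 < t → (2 * l + 1) * τ - t⁻¹ * (1 - τ ^ 2) ≤ t * E) :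
    2 * l * (1 - Real.sqrt (2 * l) / Real.sqrt ((l + 1 / 2) ^ 2 + 2 * l)) ≤ (1 - τ) * E := by
  set s := Real.sqrt (2 * l) / Real.sqrt ((l + 1 / 2) ^ 2 + 2 * l) with hs
  have hpos : 0 < (l + 1 / 2) ^ 2 + 2 * l := by positivity
  have hs0 : 0 ≤ s := by positivity
  have hs2 : s ^ 2 * ((l + 1 / 2) ^ 2 + 2 * l) = 2 * l := by
    rw [hs, div_pow, Real.sq_sqrt (by positivity), Real.sq_sqrt hpos.le,
      div_mul_cancel₀ _ hpos.ne']
  have hs1 : s ≤ 1 := by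
    by_contra! hn
    nlinarith [sq_nonneg (l + 1 / 2), mul_pos hpos (show 0 < s ^ 2 - 1 by nlinarith)]
  rcases le_or_gt τ s with hτs | hτs
  · calc 2 * l * (1 - s) ≤ E * (1 - τ) :=
        mul_le_mul hE (by linarith) (by linarith) (by linarith)
      _ = _ := mul_comm _ _
  rcases (show 0 ≤ E by linarith).eq_or_lt with hE0 | hE0
  · have : l = 0 := by linarith
    simp [this, ← hE0]
  have hτ0 : 0 < τ := hs0.trans_lt hτs
  have ha : 0 < (2 * l + 1) * τ := by positivity
  -- This `t` makes `tE` half of the first term on the left. It gives the same conclusion as the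
  -- optimal `t` and stays positive even when `τ = 1`.
  have h1 := h ((2 * l + 1) * τ / (2 * E)) (by positivity)
  have h2 : (l + 1 / 2) ^ 2 * τ ^ 2 ≤ E * (1 - τ ^ 2) := by
    have e1 : (2 * l + 1) * τ / (2 * E) * E = (2 * l + 1) * τ / 2 := by field_simp
    rw [e1, inv_div] at h1
    have h3 := mul_le_mul_of_nonneg_left h1 ha.le
    have e2 : (2 * l + 1) * τ * ((2 * l + 1) * τ - 2 * E / ((2 * l + 1) * τ) * (1 - τ ^ 2)) =
        ((2 * l + 1) * τ) ^ 2 - 2 * E * (1 - τ ^ 2) := by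
      field_simp
    rw [e2] at h3
    nlinarith
  have h4 : (l + 1 / 2) ^ 2 * s ^ 2 = 2 * l * (1 - s) * (1 + s) := by linarith
  -- Monotonicity of `τ²/(1+τ)`, cleared of denominators.
  have h5 : s ^ 2 * (1 + τ) ≤ τ ^ 2 * (1 + s) := by
    nlinarith [mul_nonneg hs0 hτ0.le, mul_nonneg (mul_nonneg hs0 hτ0.le) (sub_nonneg.mpr hτs.le)]
  have h6 := mul_le_mul_of_nonneg_left h5 (sq_nonneg (l + 1 / 2))
  have h7 : 2 * l * (1 - s) * ((1 + s) * (1 + τ)) ≤ (1 - τ) * E * ((1 + s) * (1 + τ)) := by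
    have := mul_le_mul_of_nonneg_right h2 (show 0 ≤ 1 + s by linarith)
    nlinarith
  exact le_of_mul_le_mul_right h7 (by positivity)

/-! ### Norms as integrals -/

section norms

variable {P : Finset (EuclideanSpace ℝ (Fin d))} {κ : EuclideanSpace ℝ (Fin d) → ℝ} {μ : ℝ}

theorem ballWeight_add_one {x : EuclideanSpace ℝ (Fin d)} (hx : x ∈ regularSet P κ) :
    ballWeight P κ (μ + 1) x = ballWeight P κ μ x * (1 - ‖x‖ ^ 2) := by
  rw [ballWeight, ballWeight, show μ + 1 - 1 / 2 = (μ - 1 / 2) + 1 by ring,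
    Real.rpow_add_one (one_sub_norm_sq_pos hx).ne', mul_assoc]

theorem normL2_sq (hP : ∀ v ∈ P, v ≠ 0) {V : Type*} [NormedAddCommGroup V]
    (F : EuclideanSpace ℝ (Fin d) → V) :
    normL2 P κ μ F ^ 2 = ∫ x, ‖F x‖ ^ 2 ∂ballMeasure P κ μ := by
  rw [normL2, Real.sq_sqrt, integral_ballMeasure' hP]
  · simp only [smul_eq_mul, mul_comm]
  · exact mul_nonneg normConst_nonneg (setIntegral_nonneg
      Metric.isClosed_closedBall.measurableSet fun x hx =>
        mul_nonneg (sq_nonneg _) (ballWeight_nonneg μ hx))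

theorem normConst_mul_setIntegral (hP : ∀ v ∈ P, v ≠ 0) (F : EuclideanSpace ℝ (Fin d) → ℝ) :
    normConst P κ μ * ∫ x in unitBall d, F x * ballWeight P κ (μ + 1) x =
      ∫ x, (1 - ‖x‖ ^ 2) * F x ∂ballMeasure P κ μ := by
  rw [integral_ballMeasure, ← setIntegral_congr_set (regularSet_ae_eq hP κ), smul_eq_mul]
  congr 1
  refine setIntegral_congr_fun (isOpen_regularSet P κ).measurableSet fun x hx => ?_
  simp only [ballWeight_add_one hx, smul_eq_mul]
  ring

/-- The weights differ by the factor `1 - ‖x‖² ≤ 1`, so raising `μ` by 1 does not increase the mass.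
-/
theorem normConst_le_normConst_add_one (hP : ∀ v ∈ P, v ≠ 0) (hb : normConst P κ μ ≠ 0) :
    normConst P κ μ ≤ normConst P κ (μ + 1) := by
  have := isProbabilityMeasure_ballMeasure hP hb
  have hν := ae_mem_regularSet (P := P) (κ := κ) (μ := μ)
  have h1 := normConst_mul_setIntegral (μ := μ) (κ := κ) hP fun _ => 1
  simp only [one_mul, mul_one] at h1
  have hi : Integrable (fun x : EuclideanSpace ℝ (Fin d) => 1 - ‖x‖ ^ 2) (ballMeasure P κ μ) :=
    (memLp_of_continuous ae_mem_unitBall (by fun_prop) 1).integrable le_rfl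
  have h0 : 0 ≤ᵐ[ballMeasure P κ μ] fun x => 1 - ‖x‖ ^ 2 :=
    hν.mono fun x hx => (one_sub_norm_sq_pos hx).le
  -- Strict positivity matters: a zero mass would have inverse 0 by convention.
  have hpos : 0 < ∫ x, (1 - ‖x‖ ^ 2) ∂ballMeasure P κ μ := by
    refine lt_of_le_of_ne (integral_nonneg_of_ae h0) fun h => ?_
    have h2 := (integral_eq_zero_iff_of_nonneg_ae h0 hi).mp h.symm
    obtain ⟨x, hx1, hx2⟩ := (h2.and hν).exists
    exact (one_sub_norm_sq_pos hx2).ne' hx1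
  have hle : ∫ x, (1 - ‖x‖ ^ 2) ∂ballMeasure P κ μ ≤ 1 := by
    calc _ ≤ ∫ _, (1 : ℝ) ∂ballMeasure P κ μ :=
          integral_mono hi (integrable_const _) fun x => by simp
      _ = 1 := by simp
  rw [← h1] at hpos hle
  have hI : 0 < ∫ x in unitBall d, ballWeight P κ (μ + 1) x :=
    pos_of_mul_pos_right hpos normConst_nonneg
  rw [show normConst P κ (μ + 1) = (∫ x in unitBall d, ballWeight P κ (μ + 1) x)⁻¹ from rfl]
  rwa [← one_div, le_div_iff₀ hI]

theorem memLp_of_memL2 (hP : ∀ v ∈ P, v ≠ 0) (hb : normConst P κ μ ≠ 0) {V : Type*}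
    [NormedAddCommGroup V] {F : EuclideanSpace ℝ (Fin d) → V} (hF : MemL2 P κ μ F) :
    MemLp F 2 (ballMeasure P κ μ) := by
  have hac : ballMeasure P κ μ ≪ volume.restrict (unitBall d) :=
    ballMeasure_absolutelyContinuous.trans
      (Measure.restrict_mono (regularSet_subset_unitBall P κ) le_rfl).absolutelyContinuous
  rw [memLp_two_iff_integrable_sq_norm (hF.1.mono_ac hac), integrable_ballMeasure' hP hb]
  simpa only [smul_eq_mul, mul_comm] using hF.2

/-- For a root `v`, the reflection preserves the measure and `h` but changes the sign of `⟨x, v⟩`;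
linearity extends this to the span. -/
theorem integral_inner_mul_eq_zero (hP : IsPositiveRootSystem P) (hκ : IsMultiplicity P κ)
    {h : EuclideanSpace ℝ (Fin d) → ℝ} (hi : Integrable h (ballMeasure P κ μ))
    (hinv : ∀ v ∈ P, ∀ᵐ x ∂ballMeasure P κ μ, h (refl v x) = h x)
    {w : EuclideanSpace ℝ (Fin d)}
    (hw : w ∈ Submodule.span ℝ (P : Set (EuclideanSpace ℝ (Fin d)))) :
    ∫ x, ⟪x, w⟫_ℝ * h x ∂ballMeasure P κ μ = 0 := by
  have hint : ∀ w, Integrable (fun x => ⟪x, w⟫_ℝ * h x) (ballMeasure P κ μ) := fun w => by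
    have hc : Continuous fun x : EuclideanSpace ℝ (Fin d) => ⟪x, w⟫_ℝ := by fun_prop
    exact hi.bdd_mul (c := ‖w‖) hc.aestronglyMeasurable
      (ae_mem_unitBall.mono fun x hx => abs_inner_le_of_mem hx w)
  induction hw using Submodule.span_induction with
  | mem v hv =>
    have h1 := (measurePreserving_refl (μ := μ) hP hκ hv).integral_comp
      (refl v).toHomeomorph.measurableEmbedding fun x => ⟪x, v⟫_ℝ * h x
    have h2 : ∫ x, ⟪refl v x, v⟫_ℝ * h (refl v x) ∂ballMeasure P κ μ =
        -∫ x, ⟪x, v⟫_ℝ * h x ∂ballMeasure P κ μ := by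
      rw [← integral_neg]
      refine integral_congr_ae ?_
      filter_upwards [hinv v hv] with x hx
      rw [hx, inner_refl, refl_self (hP.ne_zero v hv), inner_neg_right, neg_mul]
    change ∫ x, ⟪refl v x, v⟫_ℝ * h (refl v x) ∂ballMeasure P κ μ = _ at h1
    linarith
  | zero => simp
  | add a b _ _ ha hb' =>
    simp only [inner_add_right, add_mul]
    rw [integral_add (hint a) (hint b), ha, hb', add_zero]
  | smul c a _ ha =>
    simp only [inner_smul_right, mul_assoc]
    rw [integral_const_mul, ha, mul_zero]

end norms

/-! ### Moments of a continuous function against an integrable density -/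

section weighted

variable {ν : Measure (EuclideanSpace ℝ (Fin d))}

theorem integrable_continuous_mul (hν : ∀ᵐ x ∂ν, x ∈ unitBall d)
    {w h : EuclideanSpace ℝ (Fin d) → ℝ} (hw : Continuous w) (hh : Integrable h ν) :
    Integrable (fun x => w x * h x) ν := by
  obtain ⟨M, hM⟩ := (isCompact_closedBall (0 : EuclideanSpace ℝ (Fin d)) 1).exists_bound_of_continuousOn
    hw.continuousOn
  exact hh.bdd_mul hw.aestronglyMeasurable (hν.mono hM)

theorem integral_add_sub {α : Type*} [MeasurableSpace α] {m : Measure α} {a b c : α → ℝ}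
    (ha : Integrable a m) (hb : Integrable b m) (hc : Integrable c m) :
    ∫ x, (a x + b x - c x) ∂m = ∫ x, a x ∂m + ∫ x, b x ∂m - ∫ x, c x ∂m :=
  (integral_sub (ha.add hb) hc).trans (by rw [integral_add' ha hb])

theorem integral_quadratic_mul (hν : ∀ᵐ x ∂ν, x ∈ unitBall d)
    {ℓ h : EuclideanSpace ℝ (Fin d) → ℝ} (hℓ : Continuous ℓ) (hh : Integrable h ν)
    (a b c : ℝ) : ∫ x, (a * ℓ x ^ 2 + b * ℓ x - c) * h x ∂ν =
      a * ∫ x, ℓ x ^ 2 * h x ∂ν + b * ∫ x, ℓ x * h x ∂ν - c * ∫ x, h x ∂ν := by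
  have i1 := (integrable_continuous_mul hν (w := fun x => ℓ x ^ 2) (hℓ.pow 2) hh).const_mul a
  have i2 := (integrable_continuous_mul hν hℓ hh).const_mul b
  rw [← integral_const_mul, ← integral_const_mul, ← integral_const_mul,
    ← integral_add_sub i1 i2 (hh.const_mul c)]
  exact integral_congr_ae (Filter.Eventually.of_forall fun x => by ring)

/-- The commutator inequality with the second moment replaced by the square of the mean. -/
theorem commutator_mean_le (hν : ∀ᵐ x ∂ν, x ∈ unitBall d)
    {ℓ h : EuclideanSpace ℝ (Fin d) → ℝ} (hℓ : Continuous ℓ) (hh : Integrable h ν)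
    (hh0 : ∀ x, 0 ≤ h x) (hh1 : ∫ x, h x ∂ν = 1) {c t B : ℝ} (ht : 0 < t)
    (hB : ∫ x, (c * ℓ x - t⁻¹ * (1 - ℓ x ^ 2)) * h x ∂ν ≤ B) :
    c * (∫ x, ℓ x * h x ∂ν) - t⁻¹ * (1 - (∫ x, ℓ x * h x ∂ν) ^ 2) ≤ B := by
  set τ := ∫ x, ℓ x * h x ∂ν with hτ
  have h1 : ∫ x, (c * ℓ x - t⁻¹ * (1 - ℓ x ^ 2)) * h x ∂ν =
      ∫ x, (t⁻¹ * ℓ x ^ 2 + c * ℓ x - t⁻¹) * h x ∂ν :=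
    integral_congr_ae (Filter.Eventually.of_forall fun x => by ring)
  rw [h1, integral_quadratic_mul hν hℓ hh, hh1, ← hτ] at hB
  -- Nonnegativity of the variance `∫ (ℓ - τ)² h`, which puts the second moment above `τ²`.
  have h2 : 0 ≤ ∫ x, (1 * ℓ x ^ 2 + (-2 * τ) * ℓ x - -τ ^ 2) * h x ∂ν :=
    integral_nonneg fun x => mul_nonneg (by nlinarith [sq_nonneg (ℓ x - τ)]) (hh0 x)
  rw [integral_quadratic_mul hν hℓ hh, hh1, ← hτ] at h2
  have h3 := mul_nonneg (inv_nonneg.mpr ht.le) h2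
  linarith

end weighted

/-! ### The uncertainty inequality in each coordinate -/

section main

variable {𝕜 : Type*} [RCLike 𝕜] {P : Finset (EuclideanSpace ℝ (Fin d))}
  {κ : EuclideanSpace ℝ (Fin d) → ℝ} {μ : ℝ} {f : EuclideanSpace ℝ (Fin d) → 𝕜}
  {g : EuclideanSpace ℝ (Fin d) → EuclideanSpace 𝕜 (Fin d)}

theorem memLp_mapVec {ν : Measure (EuclideanSpace ℝ (Fin d))} (L : 𝕜 →L[ℝ] ℝ)
    (hg : MemLp g 2 ν) : MemLp (fun x => mapVec L (g x)) 2 ν :=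
  (mapVec L).comp_memLp' hg

theorem integral_add_integral_eq {α : Type*} [MeasurableSpace α] {m : Measure α} {a b c e : α → ℝ}
    (ha : Integrable a m) (hb : Integrable b m) (hc : Integrable c m)
    (h : ∀ x, c x + e x = a x + b x) :
    ∫ x, c x ∂m + ∫ x, e x ∂m = ∫ x, a x ∂m + ∫ x, b x ∂m := by
  have he : e = fun x => a x + b x - c x := funext fun x => by linarith [h x]
  rw [he, integral_add_sub ha hb hc]
  ring

/-- The energy of a function with values in `𝕜`, as the sum of those of the real and imaginary
parts. -/
theorem tripleNormSqCommon_eq (hP : ∀ v ∈ P, v ≠ 0) (hb : normConst P κ μ ≠ 0)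
    (hg : MemLp g 2 (ballMeasure P κ μ)) : tripleNormSqCommon P κ μ g =
      ∫ x, ballForm x (mapVec RCLike.reCLM (g x)) (mapVec RCLike.reCLM (g x))
        ∂ballMeasure P κ μ +
      ∫ x, ballForm x (mapVec RCLike.imCLM (g x)) (mapVec RCLike.imCLM (g x))
        ∂ballMeasure P κ μ := by
  have := isProbabilityMeasure_ballMeasure hP hb
  have hν := ae_mem_unitBall (P := P) (κ := κ) (μ := μ)
  have hre := memLp_mapVec (RCLike.reCLM (K := 𝕜)) hg
  have him := memLp_mapVec (RCLike.imCLM (K := 𝕜)) hg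
  have i1 := integrable_ballForm hν hre hre
  have i2 := integrable_ballForm hν him him
  have i3 : Integrable (fun x => (1 - ‖x‖ ^ 2) * ‖g x‖ ^ 2) (ballMeasure P κ μ) := by
    have hc : Continuous fun x : EuclideanSpace ℝ (Fin d) => 1 - ‖x‖ ^ 2 := by fun_prop
    refine (hg.integrable_norm_pow two_ne_zero).bdd_mul (c := 1) hc.aestronglyMeasurable
      (hν.mono fun x hx => ?_)
    have := mem_closedBall_zero_iff.mp hx
    rw [Real.norm_eq_abs, abs_le]
    constructor <;> nlinarith [norm_nonneg x]
  rw [tripleNormSqCommon, normConst_mul_setIntegral hP, normL2_sq hP]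
  simp only [Real.norm_eq_abs, sq_abs]
  exact integral_add_integral_eq i1 i2 i3 (angularGradNorm_sq g)

theorem tripleNormSqCommon_le (hP : ∀ v ∈ P, v ≠ 0) (hb : normConst P κ μ ≠ 0) :
    tripleNormSqCommon P κ μ g ≤ tripleNormSq P κ μ g := by
  have h0 : 0 ≤ ∫ x in unitBall d, ‖g x‖ ^ 2 * ballWeight P κ (μ + 1) x :=
    setIntegral_nonneg Metric.isClosed_closedBall.measurableSet fun x hx =>
      mul_nonneg (sq_nonneg _) (ballWeight_nonneg _ hx)
  rw [tripleNormSqCommon, tripleNormSq, normL2.eq_1 P κ (μ + 1) g,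
    Real.sq_sqrt (mul_nonneg normConst_nonneg h0)]
  gcongr
  exact normConst_le_normConst_add_one hP hb

/-- The uncertainty inequality in a fixed coordinate direction. -/
theorem uncertaintyConst_le [NeZero d] (hP : IsPositiveRootSystem P) (hκ : IsMultiplicity P κ)
    (hμ : 0 ≤ μ) (hf : MemSobolev P κ μ f) (hg : HasWeakGradient (regularSet P κ) f g)
    (hinv : IsInvariant P f) (hmean : ∫ x in unitBall d, (ballWeight P κ μ x) • f x = 0)
    (hb : normConst P κ μ ≠ 0) (hnorm : ∫ x, ‖f x‖ ^ 2 ∂ballMeasure P κ μ = 1) (i : Fin d) :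
    uncertaintyConst P κ μ ≤
        (∫ x, (1 - x i) * ‖f x‖ ^ 2 ∂ballMeasure P κ μ) * tripleNormSqCommon P κ μ g ∧
      0 ≤ ∫ x, (1 - x i) * ‖f x‖ ^ 2 ∂ballMeasure P κ μ := by
  have := isProbabilityMeasure_ballMeasure hP.ne_zero hb
  have hν := ae_mem_unitBall (P := P) (κ := κ) (μ := μ)
  obtain ⟨hf2, g', hg', hg2'⟩ := hf
  have hfm := memLp_of_memL2 hP.ne_zero hb hf2
  have hgm : MemLp g 2 (ballMeasure P κ μ) :=
    (memLp_congr_ae (ballMeasure_absolutelyContinuous.ae_le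
      (hg.ae_eq (isOpen_regularSet P κ) hg'))).mpr (memLp_of_memL2 hP.ne_zero hb hg2')
  have hinv' : ∀ v ∈ P, ∀ᵐ x ∂ballMeasure P κ μ, f (refl v x) = f x := fun v hv =>
    (ballMeasure_absolutelyContinuous.trans
      (Measure.restrict_mono (regularSet_subset_unitBall P κ) le_rfl).absolutelyContinuous).ae_le
      (hinv (refl v) (Subgroup.subset_closure ⟨v, hv, rfl⟩))
  have hmean' : ∫ x, f x ∂ballMeasure P κ μ = 0 := by
    rw [integral_ballMeasure' hP.ne_zero, hmean, smul_zero]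
  -- Every real functional of `f` inherits weak differentiability, invariance and mean zero, but not
  -- the normalization. The real bounds are quadratic, so those for the two parts add up to bounds
  -- for `|f|²`.
  have key : ∀ L : 𝕜 →L[ℝ] ℝ, _ := fun L => real_bounds hP hκ hμ hb (hg.clm_comp L)
    (L.comp_memLp' hfm) ((mapVec L).comp_memLp' hgm)
    (fun v hv => (hinv' v hv).mono fun x hx => congrArg L hx)
    ((L.integral_comp_comm (hfm.integrable one_le_two)).trans (by rw [hmean', map_zero]))
  obtain ⟨gap_re, com_re⟩ := key RCLike.reCLM
  obtain ⟨gap_im, com_im⟩ := key RCLike.imCLM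
  have hE := tripleNormSqCommon_eq hP.ne_zero hb hgm
  set E := tripleNormSqCommon P κ μ g
  have hsq := hfm.integrable_norm_pow two_ne_zero
  have hsplit : ∀ w : EuclideanSpace ℝ (Fin d) → ℝ, Continuous w →
      ∫ x, w x * ‖f x‖ ^ 2 ∂ballMeasure P κ μ =
        ∫ x, w x * RCLike.reCLM (f x) ^ 2 ∂ballMeasure P κ μ +
          ∫ x, w x * RCLike.imCLM (f x) ^ 2 ∂ballMeasure P κ μ := fun w hw => by
    have i1 := integrable_continuous_mul hν hw
      ((RCLike.reCLM (K := 𝕜)).comp_memLp' hfm).integrable_sq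
    have i2 := integrable_continuous_mul hν hw
      ((RCLike.imCLM (K := 𝕜)).comp_memLp' hfm).integrable_sq
    refine Eq.trans ?_ (integral_add i1 i2)
    refine integral_congr_ae (Filter.Eventually.of_forall fun x => ?_)
    simp only [norm_sq_eq_re_add_im, mul_add]
  have hgap : 2 * lam P κ μ ≤ E := by
    have h := add_le_add gap_re gap_im
    have h2 := hsplit (fun _ => 2 * lam P κ μ) continuous_const
    rw [integral_const_mul, hnorm, mul_one] at h2
    rw [h2, hE]
    exact h
  set S := Submodule.span ℝ (P : Set (EuclideanSpace ℝ (Fin d)))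
  set e : EuclideanSpace ℝ (Fin d) := EuclideanSpace.single i 1 with he
  -- The part of the coordinate direction fixed by the group; it is zero when the roots span the
  -- space, and then `τ = 0`.
  set u := Sᗮ.starProjection e with hu
  have hu1 : ‖u‖ ≤ 1 := by
    refine (Sᗮ.norm_starProjection_apply_le e).trans ?_
    simp [he]
  have huP : ∀ v ∈ P, ⟪v, u⟫_ℝ = 0 := fun v hv =>
    (Submodule.mem_orthogonal _ _).mp (Sᗮ.starProjection_apply_mem e) v (Submodule.subset_span hv)
  have heu : e - u ∈ S := by
    have := Sᗮ.sub_starProjection_mem_orthogonal e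
    rwa [Submodule.orthogonal_orthogonal] at this
  have hℓ : Continuous fun x : EuclideanSpace ℝ (Fin d) => ⟪x, u⟫_ℝ := by fun_prop
  set τ := ∫ x, ⟪x, u⟫_ℝ * ‖f x‖ ^ 2 ∂ballMeasure P κ μ with hτ
  have hspread : ∫ x, (1 - x i) * ‖f x‖ ^ 2 ∂ballMeasure P κ μ = 1 - τ := by
    have h0 := integral_inner_mul_eq_zero (μ := μ) hP hκ hsq
      (fun v hv => (hinv' v hv).mono fun x hx => by rw [hx]) heu
    have i1 := integrable_continuous_mul hν hℓ hsq
    have i2 := integrable_continuous_mul hν (w := fun x => ⟪x, e - u⟫_ℝ) (by fun_prop) hsq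
    have h1 : τ + 0 = ∫ x, x i * ‖f x‖ ^ 2 ∂ballMeasure P κ μ := by
      rw [hτ, ← h0, ← integral_add i1 i2]
      refine integral_congr_ae (Filter.Eventually.of_forall fun x => ?_)
      simp only [← add_mul, ← inner_add_right, add_sub_cancel]
      rw [he, EuclideanSpace.inner_single_right]
      simp
    have i3 := integrable_continuous_mul hν (w := fun x => x i) (by fun_prop) hsq
    simp only [sub_mul, one_mul]
    rw [integral_sub hsq i3, hnorm, ← h1, add_zero]
  have hτ1 : τ ≤ 1 := by
    rw [← hnorm]
    refine integral_mono_ae (integrable_continuous_mul hν hℓ hsq) hsq (hν.mono fun x hx => ?_)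
    exact mul_le_of_le_one_left (sq_nonneg _)
      ((le_abs_self _).trans ((abs_inner_le_of_mem hx u).trans hu1))
  rw [hspread]
  refine ⟨scalar_uncertainty (lam_nonneg hκ hμ) hgap hτ1 fun t ht => ?_, by linarith⟩
  have h := add_le_add (com_re u huP hu1 t ht) (com_im u huP hu1 t ht)
  rw [← hsplit _ (by fun_prop), ← mul_add, ← hE] at h
  exact commutator_mean_le hν hℓ hsq (fun x => sq_nonneg _) hnorm ht h

end main

end BallUncertainty

theorem theorem5p1 {𝕜 : Type*} [RCLike 𝕜] (d : ℕ) [NeZero d]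
    (P : Finset (EuclideanSpace ℝ (Fin d))) (hP : BallUncertainty.IsPositiveRootSystem P)
    (κ : EuclideanSpace ℝ (Fin d) → ℝ) (hκ : BallUncertainty.IsMultiplicity P κ)
    (μ : ℝ) (hμ : 0 ≤ μ)
    (f : EuclideanSpace ℝ (Fin d) → 𝕜)
    (g : EuclideanSpace ℝ (Fin d) → EuclideanSpace 𝕜 (Fin d))
    (hf : BallUncertainty.MemSobolev P κ μ f)
    (hg : BallUncertainty.HasWeakGradient (BallUncertainty.regularSet P κ) f g)
    (hinv : BallUncertainty.IsInvariant P f)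
    (hmean : ∫ x in BallUncertainty.unitBall d,
      (BallUncertainty.ballWeight P κ μ x) • f x = 0)
    (hnorm : BallUncertainty.normL2 P κ μ f = 1) :
    BallUncertainty.uncertaintyConst P κ μ ≤
        BallUncertainty.minSpread P κ μ f * BallUncertainty.tripleNormSq P κ μ g ∧
      BallUncertainty.uncertaintyConst P κ μ ≤
        BallUncertainty.minSpread P κ μ f * BallUncertainty.tripleNormSqCommon P κ μ g := by
  -- The normalization of `f` rules out the degenerate default value of the constant.
  have hb : BallUncertainty.normConst P κ μ ≠ 0 := fun h => by
    rw [BallUncertainty.normL2, h, zero_mul, Real.sqrt_zero] at hnorm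
    exact zero_ne_one hnorm
  have hnorm' := BallUncertainty.normL2_sq (κ := κ) (μ := μ) hP.ne_zero f
  rw [hnorm, one_pow] at hnorm'
  obtain ⟨i, -, hi⟩ := Finset.exists_mem_eq_inf' (Finset.univ_nonempty (α := Fin d)) fun i : Fin d =>
    BallUncertainty.normConst P κ μ * ∫ x in BallUncertainty.unitBall d,
      (1 - x i) * ‖f x‖ ^ 2 * BallUncertainty.ballWeight P κ μ x
  have hmin : BallUncertainty.minSpread P κ μ f =
      ∫ x, (1 - x i) * ‖f x‖ ^ 2 ∂BallUncertainty.ballMeasure P κ μ := by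
    rw [BallUncertainty.integral_ballMeasure' hP.ne_zero, BallUncertainty.minSpread, hi]
    simp only [smul_eq_mul, mul_comm]
  obtain ⟨h1, h2⟩ := BallUncertainty.uncertaintyConst_le hP hκ hμ hf hg hinv hmean hb
    hnorm'.symm i
  rw [hmin]
  -- Passing to the larger energy uses that the spread is nonnegative.
  exact ⟨h1.trans (mul_le_mul_of_nonneg_left
    (BallUncertainty.tripleNormSqCommon_le hP.ne_zero hb) h2), h1⟩
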